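/- Let $W$ be a complex vector space of dimension $m+1$, let $V$ be its underlying real vector space of dimension $n+2=2m+2$, and let $\mathsf J v=\mathrm i v$. Let $S\subset\mathbb PW$ be a smooth real hypersurface (a CR-hypersurface). Let $\widehat S=\{v\in V\setminus\{0\} : [v]\in S\}$ be the cone over $S$, and let $\widehat T_zS\subset V$ be the linear subspace tangent to $\widehat S$ at a point $e_0\in\widehat S$ over $z=[e_0]$. Let $\mathcal F_S$ be the set of real bases $e=(e_0,\dots,e_{n+1})$ of $V$ such that $\mathsf J e_{2a}=e_{2a+1}$ and $\mathsf J e_{2a+1}=-e_{2a}$ for $0\le a\le m$, $[e_0]\in S$, and $\mathrm{span}\{e_0,\dots,e_n\}=\widehat T_{[e_0]}S$. Let $\omega^j_k$ $(0\le j,k\le n+1)$ be the real 1-forms on $\mathcal F_S$ defined by $\mathrm d e_k=\omega^j_k\,e_j$. The indices $s,t,s_i$ run over $1,\dots,n$, and a repeated index $t$ is summed over $1,\dots,n$. For indices $s_1,\dots,s_p$, put $$T_{(s_1\dots s_j}U_{s_{j+1}\dots s_p)}=\frac1{p!}\sum_{\sigma\in S_p}T_{s_{\sigma(1)}\dots s_{\sigma(j)}}\,U_{s_{\sigma(j+1)}\dots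 s_{\sigma(p)}},$$ where an index outside the parentheses is not symmetrized. Set $h_s=0$. There exist smooth functions $h_{s_1\cdots s_q}:\mathcal F_S\to\mathbb R$ $(q\ge2)$, fully symmetric in their indices, such that $\omega^{n+1}_s=h_{st}\,\omega^t_0$ and, for every $p>1$ and all $s_1,\dots,s_p$, the following identity of 1-forms on $\mathcal F_S$ holds: $$\begin{aligned} h_{s_1\ldots s_pt}\,\omega^t_0={}&\mathrm d h_{s_1\ldots s_p}+(p-1)\,h_{s_1\ldots s_p}\,\omega^0_0+h_{s_1\ldots s_p}\,\omega^{n+1}_{n+1}\\ &+p\left\{(p-2)\,h_{(s_1\ldots s_{p-1}}\,\omega^0_{s_p)}-h_{t(s_1\ldots s_{p-1}}\,\omega^t_{s_p)}\right\}\\ &+\sum_{j=1}^{p-2}\binom pj\left\{(j-1)\,h_{(s_1\ldots s_j}\,h_{s_{j+1}\ldots s_p)}\,\omega^0_{n+1}-h_{t(s_1\ldots s_j}\,h_{s_{j+1}\ldots s_p)}\,\omega^t_{n+1}\right\}. \end{aligned}$$ Moreover, these functions are projective invariants: if $A\in\mathrm{GL}(W)$, if $h$ is such a system for $S$ and $\tilde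 h$ is such a system for $A(S)$, then for every $e\in\mathcal F_S$ the frame $Ae=(Ae_0,\dots,Ae_{n+1})$ lies in $\mathcal F_{A(S)}$, and $\tilde h_{s_1\cdots s_q}(Ae)=h_{s_1\cdots s_q}(e)$ for all $q\ge2$ and all $s_1,\dots,s_q$. (In particular, taking $A=\mathrm{Id}$, the functions $h_{s_1\cdots s_q}$ are uniquely determined by $S$.) -/

import Mathlib

open scoped ContDiff Topology LinearAlgebra.Projectivization

namespace CRProj

noncomputable section

/-! ### Smooth curves, tangent vectors and differentials on subsets of a real normed space -/

section Tangent

variable {E : Type*} [NormedAddCommGroup E] [NormedSpace ℝ E]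

/-- The tangent vectors to `M` at `x`: the velocities at time `0` of the smooth curves through `x`
that stay in `M` near time `0`.  For an embedded submanifold this is the tangent space. -/
def tangentVectors (M : Set E) (x : E) : Set E :=
  {v | ∃ c : ℝ → E, ContDiff ℝ ∞ c ∧ c 0 = x ∧ (∀ᶠ τ in 𝓝 (0 : ℝ), c τ ∈ M) ∧ HasDerivAt c v 0}

/-- The differential at `x`, in the direction `v`, of a function `f` on `M`.  It is meant for
tangent vectors `v`, where it is the derivative of `f` along any curve in `M` with velocity `v`
(see `hasDerivAt_comp_curve`). -/
def differential (M : Set E) (f : E → ℝ) (x v : E) : ℝ :=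
  fderivWithin ℝ f M x v

theorem hasDerivAt_comp_curve {M : Set E} {f : E → ℝ} {x v : E} (hf : ContDiffOn ℝ ∞ f M)
    {c : ℝ → E} (h0 : c 0 = x) (hM : ∀ᶠ τ in 𝓝 (0 : ℝ), c τ ∈ M) (hc : HasDerivAt c v 0) :
    HasDerivAt (fun τ => f (c τ)) (differential M f x v) 0 := by
  subst h0
  have hx : c 0 ∈ M := hM.self_of_nhds
  have h1 : HasFDerivWithinAt f (fderivWithin ℝ f M (c 0)) M (c 0) :=
    ((hf.differentiableOn (by simp)) _ hx).hasFDerivWithinAt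
  have h2 : HasDerivWithinAt (f ∘ c) (fderivWithin ℝ f M (c 0) v) {τ | c τ ∈ M} 0 :=
    h1.comp_hasDerivWithinAt 0 hc.hasDerivWithinAt (fun _ h => h)
  exact h2.hasDerivAt hM

end Tangent

/-! ### Hypersurfaces of `ℙ W` and adapted frames

`W` is a complex vector space of dimension `m + 1`, with its underlying real vector space `V` of
dimension `2 m + 2 = n + 2` (`n = 2 m`), and `J v = i v`.  The auxiliary norm only serves to give
the finite-dimensional space its smooth structure. -/

section Frames

variable {W : Type*} [NormedAddCommGroup W] [NormedSpace ℂ W]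

/-- The cone over `S ⊆ ℙ W`: the nonzero vectors `v` with `[v] ∈ S`. -/
def cone (S : Set (ℙ ℂ W)) : Set W :=
  {v | ∃ hv : v ≠ 0, Projectivization.mk ℂ v hv ∈ S}

/-- `S` is a smooth (embedded) real hypersurface of `ℙ W`, hence a CR-hypersurface.  As
`W \ {0} → ℙ W` is a surjective submersion, this says that the cone over `S` is a smooth real
hypersurface of `W \ {0}`: near each of its points it is the zero set of a smooth real function
whose differential does not vanish there. -/
def IsCRHypersurface (S : Set (ℙ ℂ W)) : Prop :=
  ∀ v ∈ cone S, ∃ (U : Set W) (ρ : W → ℝ), IsOpen U ∧ v ∈ U ∧ ContDiffOn ℝ ∞ ρ U ∧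
    fderiv ℝ ρ v ≠ 0 ∧ ∀ w ∈ U, (w ∈ cone S ↔ ρ w = 0)

/-- A frame: a real basis `(e_0, …, e_{n+1})` of `W` with `J e_{2a} = e_{2a+1}` and
`J e_{2a+1} = - e_{2a}` for `0 ≤ a ≤ m`. -/
structure IsFrame (m : ℕ) (e : Fin (2 * m + 2) → W) : Prop where
  linearIndependent : LinearIndependent ℝ e
  span_eq_top : ⊤ ≤ Submodule.span ℝ (Set.range e)
  J_even : ∀ (a : ℕ) (ha : a ≤ m), Complex.I • e ⟨2 * a, by omega⟩ = e ⟨2 * a + 1, by omega⟩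
  J_odd : ∀ (a : ℕ) (ha : a ≤ m), Complex.I • e ⟨2 * a + 1, by omega⟩ = - e ⟨2 * a, by omega⟩

/-- The real basis of `W` given by a frame. -/
def IsFrame.basis {m : ℕ} {e : Fin (2 * m + 2) → W} (he : IsFrame m e) :
    Module.Basis (Fin (2 * m + 2)) ℝ W :=
  Module.Basis.mk he.linearIndependent he.span_eq_top

/-- The Maurer–Cartan forms `ω^j_k` at the frame `e`, evaluated on the tangent vector
`ξ = (ξ_0, …, ξ_{n+1})`; they are determined by `d e_k = ω^j_k e_j`. -/
def IsFrame.omega {m : ℕ} {e : Fin (2 * m + 2) → W} (he : IsFrame m e)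
    (ξ : Fin (2 * m + 2) → W) (j k : Fin (2 * m + 2)) : ℝ :=
  he.basis.repr (ξ k) j

theorem IsFrame.sum_omega {m : ℕ} {e : Fin (2 * m + 2) → W} (he : IsFrame m e)
    (ξ : Fin (2 * m + 2) → W) (k : Fin (2 * m + 2)) :
    ∑ j, he.omega ξ j k • e j = ξ k := by
  have h := he.basis.sum_repr (ξ k)
  simpa [IsFrame.omega, IsFrame.basis] using h

/-- The adapted frame bundle `F_S`: the frames with `[e_0] ∈ S` and
`span {e_0, …, e_n}` the tangent space at `e_0` of the cone over `S`. -/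
def adaptedFrames (m : ℕ) (S : Set (ℙ ℂ W)) : Set (Fin (2 * m + 2) → W) :=
  {e | IsFrame m e ∧ e 0 ∈ cone S ∧
    (Submodule.span ℝ (Set.range fun j : Fin (2 * m + 1) => e j.castSucc) : Set W) =
      tangentVectors (cone S) (e 0)}

end Frames

/-! ### Symmetrization -/

/-- The indices `1, …, n` among `0, …, n + 1`; here `s : Fin n` stands for the index `s + 1`. -/
def idx {m : ℕ} (s : Fin (2 * m)) : Fin (2 * m + 2) := s.succ.castSucc

/-- The multi-index `(s_{σ(1)}, …, s_{σ(p)})`. -/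
def permute {ι : Type*} (l : List ι) (σ : Equiv.Perm (Fin l.length)) : List ι :=
  List.ofFn fun i => l.get (σ i)

/-- A covector `a_s`, as a tensor with one index. -/
def covector {ι : Type*} (a : ι → ℝ) : List ι → ℝ
  | [s] => a s
  | _ => 0

/-- The symmetrized product `T_{(s_1 … s_j} U_{s_{j+1} … s_p)}`, where `l = (s_1, …, s_p)`. -/
def symProd {ι : Type*} (j : ℕ) (T U : List ι → ℝ) (l : List ι) : ℝ :=
  (1 / (l.length.factorial : ℝ)) *
    ∑ σ : Equiv.Perm (Fin l.length), T ((permute l σ).take j) * U ((permute l σ).drop j)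

/-! ### The structure equations -/

section Structure

variable {W : Type*} [NormedAddCommGroup W] [NormedSpace ℂ W]

/-- The right-hand side of the structure equation for the multi-index `l = (s_1, …, s_p)`, at the
frame `e` and on the tangent vector `ξ`; `h l` is the function `h_{s_1 … s_p}`, and repeated
indices `t` are summed over `1, …, n`. -/
def structureRHS {m : ℕ} (S : Set (ℙ ℂ W))
    (h : List (Fin (2 * m)) → (Fin (2 * m + 2) → W) → ℝ)
    {e : Fin (2 * m + 2) → W} (he : IsFrame m e) (ξ : Fin (2 * m + 2) → W)
    (l : List (Fin (2 * m))) : ℝ :=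
  let p : ℕ := l.length
  let w := he.omega ξ
  let N : Fin (2 * m + 2) := Fin.last (2 * m + 1)
  let H : List (Fin (2 * m)) → ℝ := fun k => h k e
  differential (adaptedFrames m S) (h l) e ξ + ((p : ℝ) - 1) * H l * w 0 0 + H l * w N N
    + (p : ℝ) * (((p : ℝ) - 2) * symProd (p - 1) H (covector fun s => w 0 (idx s)) l
        - ∑ t, symProd (p - 1) (fun k => H (t :: k)) (covector fun s => w (idx t) (idx s)) l)
    + ∑ j ∈ Finset.Icc 1 (p - 2), (p.choose j : ℝ) *
        (((j : ℝ) - 1) * symProd j H H l * w 0 N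
          - ∑ t, symProd j (fun k => H (t :: k)) H l * w (idx t) N)

/-- `h = (h_{s_1 … s_p})` is a system of smooth functions on `F_S`, fully symmetric in their
indices, with `h_s = 0`, `ω^{n+1}_s = h_{st} ω^t_0`, and for every `p > 1`
`h_{s_1 … s_p t} ω^t_0 =` the right-hand side `structureRHS`, as 1-forms on `F_S`. -/
structure IsInvariantSystem {m : ℕ} (S : Set (ℙ ℂ W))
    (h : List (Fin (2 * m)) → (Fin (2 * m + 2) → W) → ℝ) : Prop where
  smooth : ∀ l, 2 ≤ l.length → ContDiffOn ℝ ∞ (h l) (adaptedFrames m S)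
  symm : ∀ l l' : List (Fin (2 * m)), 2 ≤ l.length → l.Perm l' →
    ∀ e ∈ adaptedFrames m S, h l e = h l' e
  order_one : ∀ s, ∀ e ∈ adaptedFrames m S, h [s] e = 0
  order_two : ∀ e (he : e ∈ adaptedFrames m S), ∀ ξ ∈ tangentVectors (adaptedFrames m S) e, ∀ s,
    he.1.omega ξ (Fin.last (2 * m + 1)) (idx s) = ∑ t, h [s, t] e * he.1.omega ξ (idx t) 0
  structure_eq : ∀ l, 1 < l.length → ∀ e (he : e ∈ adaptedFrames m S),
    ∀ ξ ∈ tangentVectors (adaptedFrames m S) e,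
      ∑ t, h (l ++ [t]) e * he.1.omega ξ (idx t) 0 = structureRHS S h he.1 ξ l

end Structure

end

end CRProj

/-! The invariants are Taylor coefficients. In an adapted frame `e` the cone over `S` is, near
`e_0`, a graph `y = f(x)` of points `e_0 + x^s e_s + y e_{n+1}`, and `h_{s_1 … s_p}(e)` is the
corresponding partial derivative of `f` at `0` (`taylorCoeff`). Symmetry is the commutation of
partial derivatives, and `h_s = 0` because `e_1, …, e_n` are tangent to the cone.

Smoothness and the structure equations come from one implicit function `Φ(e, x)`, defined for all
tuples `e` near a given adapted frame (`exists_isGraph`). Let `ρ` be a local equation of the cone.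
Differentiating `ρ(e_0 + x^s e_s + Φ e_{n+1}) = 0` in `x` expresses `dρ(e_s)` as a multiple of
`dρ(e_{n+1})`. The position vector is tangent to the cone, so `dρ(e_0)` is such a multiple too.
Differentiating in `e` with velocity `ξ_k = ω^j_k e_j` and dividing by `dρ(e_{n+1})` then gives
(`IsGraph.fderiv_frame_direction`) `δf = -(ω^N_0 + ω^N_s x^s + ω^N_N f) + ∂_t f (ω^t_0 + ω^t_s x^s +
ω^t_N f) + g (ω^0_0 + ω^0_s x^s + ω^0_N f)`, where `N = n + 1` and `g = f - x^t ∂_t f`.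

The structure equations are the partial derivatives of this identity at `x = 0` (`iterD_variation`).
The Leibniz rule in its symmetrized form `leib` gives the binomial sums. The Euler field multiplies
order `p` by `p`, so the coefficients of `g` are `(1 - p) h`. Since `f` vanishes to second order,
the sum over `j` stops at `p - 2`. In order one the left side vanishes, which leaves `ω^{n+1}_s =
h_{st} ω^t_0`.

For invariance, the equations express `h_{s_1 … s_p t} ω^t_0` through functions of order at most
`p`. Hence they determine all the functions by induction on the order, once `ω^1_0, …, ω^n_0` are
known to be independent on tangent vectors of the frame bundle. This is
`exists_tangentVector_adaptedFrames`, where an adapted frame is carried along a curve in the cone by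
`exists_smooth_frame`. A complex linear automorphism preserves the cones, the adapted frames and the
forms, so both systems solve the same recursion. -/

namespace CRProj

noncomputable section

/-! ### Symmetrized products and the Leibniz rule -/

section Leibniz

variable {ι : Type*}

/-- The permutation of `Fin (p + 1)` that sends `i` to `0` and is given by `σ` elsewhere. -/
def insertPerm {p : ℕ} (x : Fin (p + 1) × Equiv.Perm (Fin p)) : Equiv.Perm (Fin (p + 1)) :=
  (finSuccEquiv' x.1).trans ((Equiv.optionCongr x.2).trans (finSuccEquiv' 0).symm)

@[simp] theorem insertPerm_self {p : ℕ} (i : Fin (p + 1)) (σ : Equiv.Perm (Fin p)) :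
    insertPerm (i, σ) i = 0 := by
  simp [insertPerm]

@[simp] theorem insertPerm_succAbove {p : ℕ} (i : Fin (p + 1)) (σ : Equiv.Perm (Fin p))
    (k : Fin p) : insertPerm (i, σ) (i.succAbove k) = (σ k).succ := by
  simp [insertPerm]

theorem insertPerm_bijective {p : ℕ} : Function.Bijective (insertPerm (p := p)) := by
  rw [Fintype.bijective_iff_injective_and_card]
  constructor
  · rintro ⟨i, σ⟩ ⟨j, τ⟩ h
    have hij : i = j := by
      apply (insertPerm (j, τ)).injective
      rw [← h, insertPerm_self, h, insertPerm_self]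
    subst hij
    have : σ = τ := by
      ext k
      have := insertPerm_succAbove i σ k
      rw [h, insertPerm_succAbove] at this
      rw [Fin.succ_injective _ this]
    rw [this]
  · simp [Fintype.card_perm, Nat.factorial_succ]

@[simp] theorem length_permute (l : List ι) (σ : Equiv.Perm (Fin l.length)) :
    (permute l σ).length = l.length := by simp [permute]

theorem permute_cons (s : ι) (l : List ι) (i : Fin (l.length + 1))
    (σ : Equiv.Perm (Fin l.length)) :
    permute (s :: l) (insertPerm (i, σ)) = (permute l σ).insertIdx i s := by
  apply List.ext_getElem
  · rw [length_permute, List.length_insertIdx_of_le_length]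
    · simp
    · simpa using Nat.lt_succ_iff.1 i.2
  · intro k h1 h2
    have hk : k < l.length + 1 := by simpa using h1
    rw [List.getElem_insertIdx]
    simp only [permute, List.getElem_ofFn]
    obtain rfl | ⟨q, hq⟩ := i.eq_self_or_eq_succAbove ⟨k, hk⟩
    · simp
    · have : insertPerm (i, σ) ⟨k, hk⟩ = (σ q).succ := by rw [hq, insertPerm_succAbove]
      have hkv : k = (i.succAbove q).val := congrArg Fin.val hq
      have hL : (s :: l).get (insertPerm (i, σ) ⟨k, hk⟩) = l.get (σ q) := by
        rw [this]; rfl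
      refine hL.trans ?_
      rcases lt_or_ge q.castSucc i with h | h
      · rw [Fin.succAbove_of_castSucc_lt _ _ h] at hkv
        have hki : k < i := by rw [hkv]; exact h
        simp only [hki, ↓reduceDIte]
        congr
        exact Fin.ext hkv.symm
      · rw [Fin.succAbove_of_le_castSucc _ _ h] at hkv
        have h' : i.val ≤ q.val := h
        have hkv' : k = q.val + 1 := by rw [hkv]; rfl
        have hki : ¬ k < i := by omega
        have hki' : ¬ k = i := by omega
        simp only [hki, ↓reduceDIte, hki']
        congr
        exact Fin.ext (by simp only; omega)

/-- An entry inserted at a position `i ≤ j` falls into the first `j + 1` places and leaves the tail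
untouched. The head is only recovered up to order, which is enough for symmetric tensors. -/
theorem take_insertIdx_perm (L : List ι) (s : ι) : ∀ i j, i ≤ j → i ≤ L.length →
    ((L.insertIdx i s).take (j + 1)).Perm (s :: L.take j) ∧
      (L.insertIdx i s).drop (j + 1) = L.drop j := by
  induction L with
  | nil => intro i j hij hi; simp at hi; subst hi; simp
  | cons a L ih =>
    intro i j hij hi
    cases i with
    | zero => simp
    | succ i =>
      obtain ⟨j, rfl⟩ : ∃ k, j = k + 1 := ⟨j - 1, by omega⟩
      obtain ⟨h1, h2⟩ := ih i j (by omega) (by simpa using hi)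
      simp only [List.insertIdx_succ_cons, List.take_succ_cons, List.drop_succ_cons]
      refine ⟨?_, h2⟩
      exact (h1.cons a).trans (List.Perm.swap _ _ _)

theorem drop_insertIdx_perm (L : List ι) (s : ι) : ∀ i j, j ≤ i → i ≤ L.length →
    ((L.insertIdx i s).take j) = L.take j ∧
      ((L.insertIdx i s).drop j).Perm (s :: L.drop j) := by
  induction L with
  | nil => intro i j hij hi; simp at hi; subst hi; simp at hij; subst hij; simp
  | cons a L ih =>
    intro i j hij hi
    cases j with
    | zero => simpa using List.perm_insertIdx s (a :: L) hi
    | succ j =>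
      obtain ⟨i, rfl⟩ : ∃ k, i = k + 1 := ⟨i - 1, by omega⟩
      obtain ⟨h1, h2⟩ := ih i j (by omega) (by simpa using hi)
      simp only [List.insertIdx_succ_cons, List.take_succ_cons, List.drop_succ_cons]
      exact ⟨by rw [h1], h2⟩

/-- The sum over all permutations in the definition of `symProd`. -/
def permSum (j : ℕ) (T U : List ι → ℝ) (l : List ι) : ℝ :=
  ∑ σ : Equiv.Perm (Fin l.length), T ((permute l σ).take j) * U ((permute l σ).drop j)

/-- A tensor that is invariant under permutations of its indices. -/
def IsSymm (T : List ι → ℝ) : Prop := ∀ l l' : List ι, l.Perm l' → T l = T l'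

theorem IsSymm.cons {T : List ι → ℝ} (hT : IsSymm T) (s : ι) : IsSymm fun l => T (s :: l) :=
  fun _ _ h => hT _ _ (h.cons s)

/-- Group the permutations by the place that `s` receives: in the first `j` places it becomes an
index of `T`, in the remaining ones an index of `U`. By symmetry the exact place does not matter
otherwise. -/
theorem permSum_cons {T U : List ι → ℝ} (hT : IsSymm T) (hU : IsSymm U) (s : ι) (l : List ι)
    (j : ℕ) (hj : j ≤ l.length + 1) :
    permSum j T U (s :: l) = j * permSum (j - 1) (fun k => T (s :: k)) U l
      + (l.length + 1 - j : ℝ) * permSum j T (fun k => U (s :: k)) l := by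
  have key : permSum j T U (s :: l) = ∑ i : Fin (l.length + 1),
      ∑ σ : Equiv.Perm (Fin l.length),
        T (((permute l σ).insertIdx i s).take j) * U (((permute l σ).insertIdx i s).drop j) := by
    rw [← Fintype.sum_prod_type', permSum]
    refine ((insertPerm_bijective (p := l.length)).sum_comp (fun σ =>
      T ((permute (s :: l) σ).take j) * U ((permute (s :: l) σ).drop j))).symm.trans ?_
    refine Finset.sum_congr rfl fun x _ => ?_
    rw [← permute_cons]
  have h1 : ∀ i : Fin (l.length + 1), ∑ σ : Equiv.Perm (Fin l.length),
        T (((permute l σ).insertIdx i s).take j) * U (((permute l σ).insertIdx i s).drop j)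
      = if i.val < j then permSum (j - 1) (fun k => T (s :: k)) U l
        else permSum j T (fun k => U (s :: k)) l := by
    intro i
    have hi : i.val ≤ l.length := Nat.lt_succ_iff.1 i.2
    split_ifs with h
    · refine Finset.sum_congr rfl fun σ _ => ?_
      obtain ⟨q, rfl⟩ : ∃ q, j = q + 1 := ⟨j - 1, by omega⟩
      obtain ⟨ha, hb⟩ := take_insertIdx_perm (permute l σ) s i q (by omega) (by simpa using hi)
      rw [hT _ _ ha, hb]
      rfl
    · refine Finset.sum_congr rfl fun σ _ => ?_
      obtain ⟨ha, hb⟩ := drop_insertIdx_perm (permute l σ) s i j (by omega) (by simpa using hi)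
      rw [hU _ _ hb, ha]
  rw [key, Finset.sum_congr rfl fun i _ => h1 i,
    Fin.sum_univ_eq_sum_range (fun i => if i < j then permSum (j - 1) (fun k => T (s :: k)) U l
        else permSum j T (fun k => U (s :: k)) l) (l.length + 1)]
  obtain ⟨q, hq⟩ := Nat.exists_eq_add_of_le hj
  rw [hq, Finset.sum_range_add, Finset.sum_congr rfl (g := fun _ =>
    permSum (j - 1) (fun k => T (s :: k)) U l) (fun x hx => if_pos (Finset.mem_range.1 hx)),
    Finset.sum_congr rfl (s₁ := Finset.range q) (g := fun _ =>
    permSum j T (fun k => U (s :: k)) l) (fun x _ => if_neg (by omega))]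
  have hq' : (l.length + 1 - j : ℝ) = q := by
    have : ((l.length + 1 : ℕ) : ℝ) = j + q := by exact_mod_cast hq
    push_cast at this
    linarith
  rw [hq']
  simp

theorem choose_mul_symProd (j : ℕ) (T U : List ι → ℝ) (l : List ι) (hj : j ≤ l.length) :
    (l.length.choose j : ℝ) * symProd j T U l =
      permSum j T U l / (j.factorial * (l.length - j).factorial) := by
  rw [symProd, ← permSum, Nat.cast_choose ℝ hj]
  have := Nat.factorial_ne_zero l.length
  field_simp

/-- The Leibniz expansion: the sum of the symmetrized products over all degrees. -/
def leib (T U : List ι → ℝ) (l : List ι) : ℝ :=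
  ∑ j ∈ Finset.range (l.length + 1), (l.length.choose j : ℝ) * symProd j T U l

theorem leib_eq_sum_permSum (T U : List ι → ℝ) (l : List ι) :
    leib T U l = ∑ j ∈ Finset.range (l.length + 1),
      permSum j T U l / (j.factorial * (l.length - j).factorial) :=
  Finset.sum_congr rfl fun j hj => choose_mul_symProd j T U l
    (Nat.lt_succ_iff.1 (Finset.mem_range.1 hj))

@[simp] theorem leib_nil (T U : List ι → ℝ) : leib T U [] = T [] * U [] := by
  simp [leib, symProd, permute]

/-- After normalization the degree `j` term is `permSum / (j! (p - j)!)`; the factors `j` and `p -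
j` from `permSum_cons` each cancel one step of a factorial. This recursion is the product rule, and
it is what identifies `leib` with iterated derivatives of a product. -/
theorem leib_cons {T U : List ι → ℝ} (hT : IsSymm T) (hU : IsSymm U) (s : ι) (l : List ι) :
    leib T U (s :: l) = leib (fun k => T (s :: k)) U l + leib T (fun k => U (s :: k)) l := by
  simp only [leib_eq_sum_permSum, List.length_cons]
  have h : ∀ j ∈ Finset.range (l.length + 1 + 1),
      permSum j T U (s :: l) / (j.factorial * (l.length + 1 - j).factorial) =
      j * permSum (j - 1) (fun k => T (s :: k)) U l /
        (j.factorial * (l.length + 1 - j).factorial)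
      + (l.length + 1 - j : ℝ) * permSum j T (fun k => U (s :: k)) l /
        (j.factorial * (l.length + 1 - j).factorial) := by
    intro j hj
    rw [permSum_cons hT hU s l j (Nat.lt_succ_iff.1 (Finset.mem_range.1 hj)), add_div]
  rw [Finset.sum_congr rfl h, Finset.sum_add_distrib]
  congr 1
  · rw [Finset.sum_range_succ']
    simp only [Nat.cast_zero, zero_mul, zero_div, add_zero]
    refine Finset.sum_congr rfl fun j _ => ?_
    rw [Nat.add_sub_cancel, Nat.factorial_succ, Nat.add_sub_add_right]
    push_cast
    field_simp
  · rw [Finset.sum_range_succ]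
    simp only [Nat.cast_add, Nat.cast_one, sub_self, zero_mul, zero_div, add_zero]
    refine Finset.sum_congr rfl fun j hj => ?_
    have hj' := Finset.mem_range.1 hj
    obtain ⟨q, hq⟩ := Nat.exists_eq_add_of_le (Nat.lt_succ_iff.1 hj')
    have h1 : l.length + 1 - j = q + 1 := by omega
    have h2 : l.length - j = q := by omega
    rw [h1, h2, hq, Nat.factorial_succ]
    push_cast
    have : ((j : ℝ) + q + 1 - j) = q + 1 := by ring
    rw [this]
    field_simp

theorem symProd_congr {j : ℕ} {T T' U U' : List ι → ℝ} {l : List ι} (hj : j ≤ l.length)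
    (hT : ∀ k : List ι, k.length = j → T k = T' k)
    (hU : ∀ k : List ι, k.length = l.length - j → U k = U' k) :
    symProd j T U l = symProd j T' U' l := by
  rw [symProd, symProd]
  congr 1
  refine Finset.sum_congr rfl fun σ _ => ?_
  rw [hT _ (by simp [hj]), hU _ (by simp)]

theorem symProd_eq_zero {j : ℕ} {T U : List ι → ℝ} {l : List ι} (hj : j ≤ l.length)
    (h : (∀ k : List ι, k.length = j → T k = 0) ∨
      ∀ k : List ι, k.length = l.length - j → U k = 0) :
    symProd j T U l = 0 := by
  rw [symProd, Finset.sum_eq_zero, mul_zero]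
  intro σ _
  rcases h with h | h
  · rw [h _ (by simp [hj]), zero_mul]
  · rw [h (List.drop j _) (by simp), mul_zero]

theorem symProd_const_mul (j : ℕ) (c : ℝ) (T U : List ι → ℝ) (l : List ι) :
    symProd j (fun k => c * T k) U l = c * symProd j T U l := by
  simp only [symProd, mul_assoc, ← Finset.mul_sum]
  ring

theorem covector_eq_zero (a : ι → ℝ) (k : List ι) (hk : k.length ≠ 1) : covector a k = 0 := by
  rcases k with _ | ⟨_, _ | _⟩ <;> simp [covector] at hk ⊢

/-- A covector lives in degree one only, so a single term survives, with binomial coefficient `p`.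
This is the source of the factor `p` before the braces in the structure equation. -/
theorem leib_covector (T : List ι → ℝ) (a : ι → ℝ) (l : List ι) (hl : 1 ≤ l.length) :
    leib T (covector a) l = l.length * symProd (l.length - 1) T (covector a) l := by
  rw [leib, Finset.sum_eq_single (l.length - 1)]
  · congr 2
    rw [Nat.choose_symm hl, Nat.choose_one_right]
  · intro j hj hne
    have hj' := Finset.mem_range.1 hj
    rw [symProd_eq_zero (by omega) (Or.inr fun k hk => covector_eq_zero a k (by omega)), mul_zero]
  · intro h
    simp at h

/-- The end terms drop out: `j = 0` by the vanishing of `T`, and `j ≥ p - 1` by the vanishing of `U`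
in degrees zero and one. -/
theorem leib_eq_sum_Icc (T U : List ι → ℝ) (l : List ι) (hT : T [] = 0) (hU0 : U [] = 0)
    (hU1 : ∀ s, U [s] = 0) :
    leib T U l = ∑ j ∈ Finset.Icc 1 (l.length - 2), (l.length.choose j : ℝ) * symProd j T U l := by
  symm
  refine Finset.sum_subset (fun j hj => ?_) (fun j hj hj' => ?_)
  · simp only [Finset.mem_Icc, Finset.mem_range] at hj ⊢
    omega
  · simp only [Finset.mem_Icc, Finset.mem_range] at hj hj'
    rw [symProd_eq_zero (by omega), mul_zero]
    rcases Nat.eq_zero_or_pos j with rfl | hpos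
    · left
      intro k hk
      rw [List.length_eq_zero_iff.1 hk, hT]
    · right
      intro k hk
      have : k.length ≤ 1 := by omega
      rcases k with _ | ⟨s, _ | _⟩
      · exact hU0
      · exact hU1 s
      · simp at this

end Leibniz

/-! ### Iterated directional derivatives -/

section IterD

variable {ι E : Type*} [NormedAddCommGroup E] [NormedSpace ℝ E]

/-- The iterated derivative of `F` in the directions `b s`, `s ∈ l`. -/
def iterD (b : ι → E) : List ι → (E → ℝ) → E → ℝ
  | [], F => F
  | s :: l, F => iterD b l fun x => fderiv ℝ F x (b s)

variable {b : ι → E} {O : Set E} {F G : E → ℝ}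

theorem contDiffOn_dirD (hO : IsOpen O) (hF : ContDiffOn ℝ ∞ F O) (v : E) :
    ContDiffOn ℝ ∞ (fun x => fderiv ℝ F x v) O :=
  (hF.fderiv_of_isOpen hO (m := ∞) (by simp)).clm_apply contDiffOn_const

theorem differentiableAt_of_contDiffOn (hO : IsOpen O) (hF : ContDiffOn ℝ ∞ F O) {x : E}
    (hx : x ∈ O) : DifferentiableAt ℝ F x :=
  (hF.contDiffAt (hO.mem_nhds hx)).differentiableAt (by simp)

theorem dirD_congr (hO : IsOpen O) (h : Set.EqOn F G O) (v : E) :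
    Set.EqOn (fun x => fderiv ℝ F x v) (fun x => fderiv ℝ G x v) O := fun x hx => by
  have : F =ᶠ[𝓝 x] G := Filter.eventuallyEq_of_mem (hO.mem_nhds hx) h
  simp only [this.fderiv_eq]

theorem contDiffOn_iterD (hO : IsOpen O) (hF : ContDiffOn ℝ ∞ F O) (l : List ι) :
    ContDiffOn ℝ ∞ (iterD b l F) O := by
  induction l generalizing F with
  | nil => exact hF
  | cons s l ih => exact ih (contDiffOn_dirD hO hF _)

theorem iterD_congr (hO : IsOpen O) (h : Set.EqOn F G O) (l : List ι) :
    Set.EqOn (iterD b l F) (iterD b l G) O := by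
  induction l generalizing F G with
  | nil => exact h
  | cons s l ih => exact ih (dirD_congr hO h _)

theorem iterD_congr_of_eventuallyEq {x : E} (h : F =ᶠ[𝓝 x] G) (l : List ι) :
    iterD b l F x = iterD b l G x := by
  obtain ⟨O, hO, hO', hx⟩ := eventually_nhds_iff.1 h
  exact iterD_congr hO' (fun y hy => hO y hy) l hx

theorem iterD_add (hO : IsOpen O) (hF : ContDiffOn ℝ ∞ F O) (hG : ContDiffOn ℝ ∞ G O)
    (l : List ι) :
    Set.EqOn (iterD b l fun x => F x + G x) (fun x => iterD b l F x + iterD b l G x) O := by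
  induction l generalizing F G with
  | nil => exact fun x _ => rfl
  | cons s l ih =>
    refine (iterD_congr hO (fun x hx => ?_) l).trans
      (ih (contDiffOn_dirD hO hF (b s)) (contDiffOn_dirD hO hG (b s)))
    rw [fderiv_fun_add (differentiableAt_of_contDiffOn hO hF hx)
      (differentiableAt_of_contDiffOn hO hG hx)]
    rfl

theorem iterD_const (c : ℝ) (l : List ι) (x : E) :
    iterD b l (fun _ => c) x = if l = [] then c else 0 := by
  induction l generalizing c with
  | nil => simp [iterD]
  | cons s l ih => simp [iterD, ih]

theorem iterD_const_mul (hO : IsOpen O) (hF : ContDiffOn ℝ ∞ F O) (c : ℝ) (l : List ι) :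
    Set.EqOn (iterD b l fun x => c * F x) (fun x => c * iterD b l F x) O := by
  induction l generalizing F with
  | nil => exact fun x _ => rfl
  | cons s l ih =>
    refine (iterD_congr hO (fun x hx => ?_) l).trans (ih (contDiffOn_dirD hO hF (b s)))
    rw [fderiv_const_mul (differentiableAt_of_contDiffOn hO hF hx)]
    rfl

theorem iterD_sum {κ : Type*} (A : Finset κ) {f : κ → E → ℝ} (hO : IsOpen O)
    (hf : ∀ i ∈ A, ContDiffOn ℝ ∞ (f i) O) (l : List ι) :
    Set.EqOn (iterD b l fun x => ∑ i ∈ A, f i x) (fun x => ∑ i ∈ A, iterD b l (f i) x) O := by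
  classical
  induction A using Finset.induction_on with
  | empty =>
    intro x _
    simp [iterD_const]
  | insert i A hi ih =>
    have h1 : ∀ i ∈ A, ContDiffOn ℝ ∞ (f i) O := fun j hj => hf j (Finset.mem_insert_of_mem hj)
    intro x hx
    simp only [Finset.sum_insert hi]
    rw [iterD_add hO (hf i (Finset.mem_insert_self _ _)) (ContDiffOn.sum h1) l hx]
    simp only
    rw [ih h1 hx]

theorem dirD_comm (hO : IsOpen O) (hF : ContDiffOn ℝ ∞ F O) (u v : E) :
    Set.EqOn (fun x => fderiv ℝ (fun y => fderiv ℝ F y u) x v)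
      (fun x => fderiv ℝ (fun y => fderiv ℝ F y v) x u) O := by
  intro x hx
  have hc := hF.contDiffAt (hO.mem_nhds hx)
  have hs : IsSymmSndFDerivAt ℝ F x :=
    hc.isSymmSndFDerivAt (by
      rw [minSmoothness_of_isRCLikeNormedField]
      exact WithTop.coe_le_coe.2 le_top)
  have hd : DifferentiableAt ℝ (fderiv ℝ F) x :=
    (hc.fderiv_right (m := ∞) (by simp)).differentiableAt (by simp)
  have h : ∀ w, fderiv ℝ (fun y => fderiv ℝ F y w) x = (fderiv ℝ (fderiv ℝ F) x).flip w := by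
    intro w
    ext z
    rw [fderiv_clm_apply hd (differentiableAt_const w)]
    simp
  simp only [h]
  exact hs.eq v u

theorem iterD_perm (hO : IsOpen O) (hF : ContDiffOn ℝ ∞ F O) {l l' : List ι} (h : l.Perm l') :
    Set.EqOn (iterD b l F) (iterD b l' F) O := by
  induction h generalizing F with
  | nil => exact fun _ _ => rfl
  | cons s _ ih => exact ih (contDiffOn_dirD hO hF _)
  | swap s t l => exact iterD_congr hO (dirD_comm hO hF _ _) l
  | trans _ _ ih1 ih2 => exact (ih1 hF).trans (ih2 hF)

theorem isSymm_iterD (hO : IsOpen O) (hF : ContDiffOn ℝ ∞ F O) {x : E} (hx : x ∈ O) :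
    IsSymm fun l => iterD b l F x := fun _ _ h => iterD_perm hO hF h hx

/-- Used with `v` a direction of moving frames: the differential of a Taylor coefficient becomes a
Taylor coefficient of the variation of the graph. -/
theorem dirD_iterD (hO : IsOpen O) (hF : ContDiffOn ℝ ∞ F O) (v : E) (l : List ι) :
    Set.EqOn (fun x => fderiv ℝ (iterD b l F) x v) (iterD b l fun x => fderiv ℝ F x v) O := by
  induction l generalizing F with
  | nil => exact fun _ _ => rfl
  | cons s l ih =>
    exact (ih (contDiffOn_dirD hO hF (b s))).trans (iterD_congr hO (dirD_comm hO hF _ _) l)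

theorem iterD_mul (hO : IsOpen O) (hF : ContDiffOn ℝ ∞ F O) (hG : ContDiffOn ℝ ∞ G O)
    (l : List ι) {x : E} (hx : x ∈ O) :
    iterD b l (fun y => F y * G y) x =
      leib (fun k => iterD b k F x) (fun k => iterD b k G x) l := by
  induction l generalizing F G with
  | nil => simp [iterD]
  | cons s l ih =>
    have hF' := contDiffOn_dirD hO hF (b s)
    have hG' := contDiffOn_dirD hO hG (b s)
    rw [leib_cons (isSymm_iterD hO hF hx) (isSymm_iterD hO hG hx)]
    have h : Set.EqOn (fun y => fderiv ℝ (fun z => F z * G z) y (b s))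
        (fun y => fderiv ℝ F y (b s) * G y + F y * fderiv ℝ G y (b s)) O := by
      intro y hy
      simp only
      rw [fderiv_fun_mul (differentiableAt_of_contDiffOn hO hF hy)
        (differentiableAt_of_contDiffOn hO hG hy)]
      simp
      ring
    rw [iterD, iterD_congr hO h l hx, iterD_add hO (hF'.mul hG) (hF.mul hG') l hx]
    simp only
    rw [ih hF' hG, ih hF hG']
    rfl

theorem iterD_clm (L : E →L[ℝ] ℝ) (l : List ι) (x : E) (hx : L x = 0) :
    iterD b l L x = covector (fun s => L (b s)) l := by
  rcases l with _ | ⟨s, l⟩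
  · simpa [iterD, covector] using hx
  · simp only [iterD, ContinuousLinearMap.fderiv, iterD_const]
    rcases l with _ | _ <;> simp [covector]

end IterD

/-! ### Partial derivatives on a product and on its slices -/

section Slices

variable {ι E X : Type*} [NormedAddCommGroup E] [NormedSpace ℝ E] [NormedAddCommGroup X]
  [NormedSpace ℝ X]

theorem iterD_slice {b : ι → X} {O : Set (E × X)} {F : E × X → ℝ} (hO : IsOpen O)
    (hF : ContDiffOn ℝ ∞ F O) (l : List ι) {e : E} {x : X} (h : (e, x) ∈ O) :
    iterD (fun s => ((0 : E), b s)) l F (e, x) = iterD b l (fun y => F (e, y)) x := by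
  induction l generalizing F with
  | nil => rfl
  | cons s l ih =>
    rw [iterD, ih (contDiffOn_dirD hO hF _), iterD]
    have hO' : IsOpen {y : X | (e, y) ∈ O} := hO.preimage (by fun_prop)
    refine iterD_congr hO' (fun y hy => ?_) l h
    have h1 := (differentiableAt_of_contDiffOn hO hF hy).hasFDerivAt
    have h2 : HasFDerivAt (fun y : X => (e, y)) (ContinuousLinearMap.inr ℝ E X) y :=
      hasFDerivAt_prodMk_right e y
    have h3 := (h1.comp y h2).fderiv
    simp only [Function.comp_def] at h3
    simp only [h3]
    rfl

end Slices

/-! ### Derivatives of the Euler field -/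

section Euler

variable {ι : Type*} [Fintype ι] [DecidableEq ι]

/-- The standard basis vectors of `ℝ^ι`. -/
abbrev unitVec (s : ι) : ι → ℝ := Pi.single s 1

/-- Each differentiation of `x^t ∂_t F` hits a coordinate once and contributes one more copy of the
derivative of `F`. At the origin only the count `l.length` remains. -/
theorem iterD_euler {O : Set (ι → ℝ)} {F : (ι → ℝ) → ℝ} (hO : IsOpen O)
    (hF : ContDiffOn ℝ ∞ F O) (l : List ι) :
    Set.EqOn (iterD unitVec l fun x => ∑ t, x t * fderiv ℝ F x (unitVec t))
      (fun x => l.length * iterD unitVec l F x + ∑ t, x t * iterD unitVec (t :: l) F x) O := by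
  induction l generalizing F with
  | nil => intro x _; simp [iterD]
  | cons s l ih =>
    have hs := contDiffOn_dirD hO hF (unitVec s)
    have hcoord : ∀ t : ι, ContDiffOn ℝ ∞ (fun x : ι → ℝ => x t) O := fun t => by fun_prop
    have h : Set.EqOn
        (fun x => fderiv ℝ (fun x => ∑ t, x t * fderiv ℝ F x (unitVec t)) x (unitVec s))
        (fun x => fderiv ℝ F x (unitVec s) +
          ∑ t, x t * fderiv ℝ (fun y => fderiv ℝ F y (unitVec s)) x (unitVec t)) O := by
      intro x hx
      have hx' : ∀ t : ι, HasFDerivAt (fun x : ι → ℝ => x t)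
        (ContinuousLinearMap.proj (R := ℝ) (φ := fun _ : ι => ℝ) t) x := fun t =>
        hasFDerivAt_apply t x
      have h1 := HasFDerivAt.fun_sum (u := Finset.univ) fun (t : ι) _ => (hx' t).mul
        (differentiableAt_of_contDiffOn hO (contDiffOn_dirD hO hF (unitVec t)) hx).hasFDerivAt
      have h2 := congrArg (fun L => L (unitVec s)) h1.fderiv
      refine h2.trans ?_
      simp only [sum_apply, add_apply,
        smul_apply, ContinuousLinearMap.proj_apply, smul_eq_mul,
        Finset.sum_add_distrib, Pi.single_apply]
      rw [add_comm]
      congr 1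
      · simp
      · refine Finset.sum_congr rfl fun t _ => ?_
        exact congrArg (x t * ·) (dirD_comm hO hF (unitVec t) (unitVec s) hx)
    intro x hx
    rw [iterD, iterD_congr hO h l hx, iterD_add hO hs
      (ContDiffOn.sum fun t _ => (hcoord t).mul (contDiffOn_dirD hO hs _)) l hx]
    simp only
    rw [ih hs hx]
    simp only [List.length_cons, iterD]
    have h2 : ∀ t, iterD unitVec l
        (fun y => fderiv ℝ (fun z => fderiv ℝ F z (unitVec s)) y (unitVec t)) x =
        iterD unitVec l
        (fun y => fderiv ℝ (fun z => fderiv ℝ F z (unitVec t)) y (unitVec s)) x := fun t =>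
      iterD_congr hO (dirD_comm hO hF _ _) l hx
    simp only [h2]
    push_cast
    ring

end Euler

/-! ### The implicit function theorem on an open set -/

theorem exists_implicit {P : Type*} [NormedAddCommGroup P] [NormedSpace ℝ P] [CompleteSpace P]
    {Ω : Set (P × ℝ)} (hΩ : IsOpen Ω) {G : P × ℝ → ℝ} (hG : ContDiffOn ℝ ∞ G Ω) {u : P × ℝ}
    (hu : u ∈ Ω) (h0 : G u = 0) (h1 : fderiv ℝ G u (0, 1) ≠ 0) :
    ∃ (O : Set P) (φ : P → ℝ), IsOpen O ∧ u.1 ∈ O ∧ ContDiffOn ℝ ∞ φ O ∧ φ u.1 = u.2 ∧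
      (∀ p ∈ O, (p, φ p) ∈ Ω ∧ G (p, φ p) = 0 ∧ fderiv ℝ G (p, φ p) (0, 1) ≠ 0) ∧
      ∀ᶠ q in 𝓝 u, G q = 0 → q.2 = φ q.1 := by
  have hinv : ∀ v, fderiv ℝ G v (0, 1) ≠ 0 →
      (fderiv ℝ G v ∘L .inr ℝ P ℝ).IsInvertible := by
    intro v hv
    refine ⟨ContinuousLinearEquiv.unitsEquivAut ℝ (Units.mk0 _ hv), ?_⟩
    ext
    simp
  have hinf : (∞ : ℕ∞ω) ≠ 0 := by simp
  have hGu := hG.contDiffAt (hΩ.mem_nhds hu)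
  let φ := hGu.implicitFunction hinf (hinv u h1)
  have hφu : φ u.1 = u.2 := hGu.implicitFunction_apply_self hinf (hinv u h1)
  have hφ : ContDiffAt ℝ ∞ φ u.1 := hGu.contDiffAt_implicitFunction hinf (hinv u h1)
  have hiff : ∀ᶠ q in 𝓝 u, G q = 0 ↔ φ q.1 = q.2 := by
    have := hGu.eventually_apply_eq_iff_implicitFunction hinf (hinv u h1)
    rwa [h0] at this
  have hder : ∀ᶠ q in 𝓝 u, fderiv ℝ G q (0, 1) ≠ 0 :=
    ((contDiffOn_dirD hΩ hG (0, 1)).continuousOn.continuousAt (hΩ.mem_nhds hu)).eventually_ne h1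
  obtain ⟨Y, hY, hYo, huY⟩ := eventually_nhds_iff.1
    ((hiff.and hder).and (hΩ.mem_nhds hu))
  have htend : ∀ᶠ p in 𝓝 u.1, (p, φ p) ∈ Y := by
    have : ContinuousAt (fun p => (p, φ p)) u.1 := continuousAt_id.prodMk hφ.continuousAt
    refine this.eventually (hYo.mem_nhds ?_)
    simpa only [hφu] using huY
  obtain ⟨O, hOp, hO, huO⟩ := eventually_nhds_iff.1 htend
  refine ⟨O, φ, hO, huO, fun p hp => ContDiffAt.contDiffWithinAt ?_, hφu, fun p hp => ?_, ?_⟩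
  -- Smoothness of `φ` at the base point alone gives no single neighbourhood that serves all finite
  -- orders. The implicit function theorem is therefore applied again at each nearby `p`, and its
  -- solution `ψ` agrees with `φ` by the uniqueness that holds throughout `Y`.
  · have hpY := hOp p hp
    obtain ⟨⟨hi, hd⟩, hpΩ⟩ := hY _ hpY
    have hGp := hG.contDiffAt (hΩ.mem_nhds hpΩ)
    have hzero : G (p, φ p) = 0 := hi.2 rfl
    let ψ := hGp.implicitFunction hinf (hinv _ hd)
    have hψp : ψ p = φ p := hGp.implicitFunction_apply_self hinf (hinv _ hd)
    have hψ : ContDiffAt ℝ ∞ ψ p := hGp.contDiffAt_implicitFunction hinf (hinv _ hd)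
    have hψ0 : ∀ᶠ q in 𝓝 p, G (q, ψ q) = 0 := by
      have := hGp.eventually_apply_implicitFunction hinf (hinv _ hd)
      rwa [hzero] at this
    have hψY : ∀ᶠ q in 𝓝 p, (q, ψ q) ∈ Y := by
      have : ContinuousAt (fun q => (q, ψ q)) p := continuousAt_id.prodMk hψ.continuousAt
      refine this.eventually (hYo.mem_nhds ?_)
      simpa only [hψp] using hpY
    refine hψ.congr_of_eventuallyEq ?_
    filter_upwards [hψ0, hψY] with q hq0 hqY
    exact (hY _ hqY).1.1.1 hq0
  · have hpY := hOp p hp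
    obtain ⟨⟨hi, hd⟩, hpΩ⟩ := hY _ hpY
    exact ⟨hpΩ, hi.2 rfl, hd⟩
  · exact hiff.mono fun q hq h => (hq.1 h).symm

/-! ### Smooth curves and the tangent spaces of the cone -/

/-- Multiply by a bump function. It is needed because `tangentVectors` asks for curves smooth on all
of `ℝ`, while the constructions below give them near `0` only. -/
theorem exists_contDiff_eventuallyEq {E : Type*} [NormedAddCommGroup E] [NormedSpace ℝ E]
    {O : Set ℝ} (hO : IsOpen O) (h0 : (0 : ℝ) ∈ O) {c : ℝ → E} (hc : ContDiffOn ℝ ∞ c O) :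
    ∃ c' : ℝ → E, ContDiff ℝ ∞ c' ∧ c' =ᶠ[𝓝 0] c := by
  obtain ⟨r, hr, hrO⟩ := Metric.isOpen_iff.1 hO 0 h0
  let f : ContDiffBump (0 : ℝ) := ⟨r / 4, r / 2, by positivity, by linarith⟩
  refine ⟨fun τ => f τ • c τ, contDiff_iff_contDiffAt.2 fun τ => ?_, ?_⟩
  · by_cases hτ : τ ∈ Metric.ball (0 : ℝ) r
    · exact f.contDiffAt.smul (hc.contDiffAt (hO.mem_nhds (hrO hτ)))
    · have hs : τ ∉ tsupport f := by
        rw [f.tsupport_eq]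
        intro h
        exact hτ (Metric.closedBall_subset_ball (show f.rOut < r from half_lt_self hr) h)
      have h1 : (fun τ => f τ • c τ) =ᶠ[𝓝 τ] fun _ => 0 := by
        filter_upwards [notMem_tsupport_iff_eventuallyEq.1 hs] with σ hσ
        simp only [hσ, Pi.zero_apply, zero_smul]
      exact contDiffAt_const.congr_of_eventuallyEq h1
  · filter_upwards [f.eventuallyEq_one] with τ hτ
    simp only [hτ, Pi.one_apply, one_smul]

section Cone

variable {W : Type*} [NormedAddCommGroup W] [NormedSpace ℂ W] {S : Set (ℙ ℂ W)}

theorem cone_smul {v : W} {c : ℂ} (hc : c ≠ 0) : c • v ∈ cone S ↔ v ∈ cone S := by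
  have key : ∀ (hv : v ≠ 0) (hcv : c • v ≠ 0),
      Projectivization.mk ℂ (c • v) hcv = Projectivization.mk ℂ v hv := fun hv hcv =>
    (Projectivization.mk_eq_mk_iff' ℂ _ _ hcv hv).2 ⟨c, rfl⟩
  constructor
  · rintro ⟨hcv, h⟩
    have hv : v ≠ 0 := fun h => hcv (by rw [h, smul_zero])
    exact ⟨hv, key hv hcv ▸ h⟩
  · rintro ⟨hv, h⟩
    have hcv := smul_ne_zero hc hv
    exact ⟨hcv, (key hv hcv).symm ▸ h⟩

/-- The orbit `exp(τ c) v` stays in the cone. With `c = 1` this gives the homogeneity relation for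
`dρ`, and with `c = i` the tangency of `J e_0`. -/
theorem smul_mem_tangentVectors {v : W} (hv : v ∈ cone S) (c : ℂ) :
    c • v ∈ tangentVectors (cone S) v := by
  have hs : ContDiff ℝ ∞ fun τ : ℝ => Complex.exp (τ * c) :=
    Complex.contDiff_exp.comp (Complex.ofRealCLM.contDiff.mul contDiff_const)
  refine ⟨fun τ => Complex.exp (τ * c) • v, hs.smul contDiff_const, by simp,
    Filter.Eventually.of_forall fun τ => (cone_smul (Complex.exp_ne_zero _)).2 hv, ?_⟩
  have h1 : HasDerivAt (fun τ : ℝ => Complex.exp (τ * c)) c 0 := by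
    have := ((Complex.ofRealCLM.hasDerivAt (x := (0 : ℝ))).mul_const c).cexp
    simpa using this
  simpa using h1.smul_const v

/-- `ρ` is a smooth equation of the cone over `S` in the open set `U`. -/
structure IsLocalEquation (S : Set (ℙ ℂ W)) (U : Set W) (ρ : W → ℝ) : Prop where
  isOpen : IsOpen U
  smooth : ContDiffOn ℝ ∞ ρ U
  mem_cone_iff : ∀ w ∈ U, (w ∈ cone S ↔ ρ w = 0)

namespace IsLocalEquation

variable {U : Set W} {ρ : W → ℝ} (h : IsLocalEquation S U ρ)
include h

theorem fderiv_eq_zero {v u : W} (hv : v ∈ U) (hu : u ∈ tangentVectors (cone S) v) :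
    fderiv ℝ ρ v u = 0 := by
  obtain ⟨c, -, rfl, hS, hd⟩ := hu
  have h1 := (differentiableAt_of_contDiffOn h.isOpen h.smooth hv).hasFDerivAt.comp_hasDerivAt 0 hd
  have h2 : ρ ∘ c =ᶠ[𝓝 0] fun _ => 0 := by
    filter_upwards [hS, hd.continuousAt.eventually (h.isOpen.mem_nhds hv)] with τ h1 h2
    exact (h.mem_cone_iff _ h2).1 h1
  exact h1.unique ((hasDerivAt_const (0 : ℝ) (0 : ℝ)).congr_of_eventuallyEq h2)

/-- For `u` in the kernel, choose `w` transversal and correct the line `v + τ u` to a curve `v + τ u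
+ φ(τ) w` in the cone by the implicit function theorem. -/
theorem tangentVectors_eq {v : W} (hv : v ∈ U) (hS : v ∈ cone S) (hd : fderiv ℝ ρ v ≠ 0) :
    tangentVectors (cone S) v = {u | fderiv ℝ ρ v u = 0} := by
  refine Set.Subset.antisymm (fun u hu => h.fderiv_eq_zero hv hu) fun u hu => ?_
  obtain ⟨w, hw⟩ : ∃ w, fderiv ℝ ρ v w ≠ 0 := by
    by_contra! h'
    exact hd (ContinuousLinearMap.ext h')
  let L : ℝ × ℝ → W := fun q => v + q.1 • u + q.2 • w
  have hL : ContDiff ℝ ∞ L := by fun_prop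
  have hL0 : L (0, 0) = v := by simp [L]
  have hΩ : IsOpen (L ⁻¹' U) := h.isOpen.preimage hL.continuous
  have hG : ContDiffOn ℝ ∞ (ρ ∘ L) (L ⁻¹' U) := h.smooth.comp hL.contDiffOn fun _ h => h
  have hu0 : ((0 : ℝ), (0 : ℝ)) ∈ L ⁻¹' U := by rw [Set.mem_preimage, hL0]; exact hv
  have hρ : HasFDerivAt ρ (fderiv ℝ ρ v) (L (0, 0)) := by
    rw [hL0]
    exact (differentiableAt_of_contDiffOn h.isOpen h.smooth hv).hasFDerivAt
  have hline : ∀ {φ : ℝ → ℝ × ℝ} {a b : ℝ}, HasDerivAt φ (a, b) 0 →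
      HasDerivAt (fun τ => L (φ τ)) (a • u + b • w) 0 := by
    intro φ a b hφ
    have h1 : HasDerivAt (fun τ => (φ τ).1) a 0 :=
      (hasFDerivAt_fst (𝕜 := ℝ) (p := φ 0)).comp_hasDerivAt 0 hφ
    have h2 : HasDerivAt (fun τ => (φ τ).2) b 0 :=
      (hasFDerivAt_snd (𝕜 := ℝ) (p := φ 0)).comp_hasDerivAt 0 hφ
    exact ((h1.smul_const u).const_add v).add (h2.smul_const w)
  have hρL : ∀ {φ : ℝ → ℝ × ℝ} {a b : ℝ}, φ 0 = (0, 0) → HasDerivAt φ (a, b) 0 →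
      HasDerivAt (fun τ => ρ (L (φ τ))) (b * fderiv ℝ ρ v w) 0 := by
    intro φ a b h0 hφ
    have h1 := HasFDerivAt.comp_hasDerivAt (l := ρ) (f := fun τ => L (φ τ)) (l' := fderiv ℝ ρ v)
      0 (by simp only [h0]; exact hρ) (hline hφ)
    have h2 : fderiv ℝ ρ v (a • u + b • w) = b * fderiv ℝ ρ v w := by
      rw [map_add, map_smul, map_smul, show fderiv ℝ ρ v u = 0 from hu]
      simp
    rwa [h2] at h1
  have hGd : fderiv ℝ (ρ ∘ L) (0, 0) (0, 1) = fderiv ℝ ρ v w := by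
    have h1 : HasDerivAt (fun τ : ℝ => ((0 : ℝ), τ)) (0, 1) 0 :=
      (hasDerivAt_const _ _).prodMk (hasDerivAt_id _)
    have h2 := (differentiableAt_of_contDiffOn hΩ hG hu0).hasFDerivAt.comp_hasDerivAt
      (f := fun τ : ℝ => ((0 : ℝ), τ)) 0 h1
    have h3 := h2.unique (hρL rfl h1)
    rw [h3, one_mul]
  obtain ⟨O, φ, hO, h0O, hφ, hφ0, hzero, -⟩ := exists_implicit hΩ hG hu0
    (by rw [Function.comp_apply, hL0]; exact (h.mem_cone_iff v hv).1 hS) (by rw [hGd]; exact hw)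
  have hφd : HasDerivAt φ (deriv φ 0) 0 :=
    (differentiableAt_of_contDiffOn hO hφ h0O).hasDerivAt
  have hpair : HasDerivAt (fun τ => (τ, φ τ)) (1, deriv φ 0) 0 := (hasDerivAt_id _).prodMk hφd
  have hp0 : ((0 : ℝ), φ 0) = (0, 0) := by rw [hφ0]
  -- Differentiating `ρ = 0` along the corrected curve gives `φ'(0) dρ(w) = 0`, because `dρ(u) = 0`;
  -- so the correction does not change the velocity.
  have hder0 : deriv φ 0 = 0 := by
    have h1 := hρL hp0 hpair
    have h2 : (fun τ => ρ (L (τ, φ τ))) =ᶠ[𝓝 0] fun _ => 0 := by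
      filter_upwards [hO.mem_nhds h0O] with τ hτ
      exact (hzero τ hτ).2.1
    have h3 := h1.unique ((hasDerivAt_const (0 : ℝ) (0 : ℝ)).congr_of_eventuallyEq h2)
    exact (mul_eq_zero.1 h3).resolve_right hw
  have hcO : ContDiffOn ℝ ∞ (fun τ => L (τ, φ τ)) O :=
    hL.comp_contDiffOn (contDiffOn_id.prodMk hφ)
  obtain ⟨c, hc, hce⟩ := exists_contDiff_eventuallyEq hO h0O hcO
  refine ⟨c, hc, ?_, ?_, ?_⟩
  · exact hce.self_of_nhds.trans ((congrArg L hp0).trans hL0)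
  · filter_upwards [hce, hO.mem_nhds h0O] with τ h1 h2
    rw [h1]
    obtain ⟨h3, h4, -⟩ := hzero τ h2
    exact (h.mem_cone_iff _ h3).2 h4
  · have h1 := hline hpair
    rw [hder0, one_smul, zero_smul, add_zero] at h1
    exact h1.congr_of_eventuallyEq hce

end IsLocalEquation

theorem IsCRHypersurface.exists_isLocalEquation (hS : IsCRHypersurface S) {v : W}
    (hv : v ∈ cone S) : ∃ U ρ, IsLocalEquation S U ρ ∧ v ∈ U ∧ fderiv ℝ ρ v ≠ 0 := by
  obtain ⟨U, ρ, h1, h2, h3, h4, h5⟩ := hS v hv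
  exact ⟨U, ρ, ⟨h1, h3, h5⟩, h2, h4⟩

theorem castSucc_mem_tangentVectors {m : ℕ} {e : Fin (2 * m + 2) → W}
    (he : e ∈ adaptedFrames m S) (j : Fin (2 * m + 1)) :
    e j.castSucc ∈ tangentVectors (cone S) (e 0) := by
  rw [← he.2.2]
  exact Submodule.subset_span ⟨j, rfl⟩

theorem fderiv_last_ne_zero {m : ℕ} {e : Fin (2 * m + 2) → W} (he : e ∈ adaptedFrames m S)
    {U : Set W} {ρ : W → ℝ} (h : IsLocalEquation S U ρ) (hU : e 0 ∈ U)
    (hd : fderiv ℝ ρ (e 0) ≠ 0) : fderiv ℝ ρ (e 0) (e (Fin.last _)) ≠ 0 := by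
  intro h0
  apply hd
  have h1 : ∀ j, fderiv ℝ ρ (e 0) (e j) = 0 := by
    intro j
    induction j using Fin.lastCases with
    | last => exact h0
    | cast j => exact h.fderiv_eq_zero hU (castSucc_mem_tangentVectors he j)
  have h2 : ⊤ ≤ LinearMap.ker (fderiv ℝ ρ (e 0)).toLinearMap := by
    refine he.1.span_eq_top.trans (Submodule.span_le.2 ?_)
    rintro _ ⟨j, rfl⟩
    exact h1 j
  ext w
  exact h2 (Submodule.mem_top (x := w))

end Cone

/-! ### The local graph of the cone in a frame -/

section Graph

variable {W : Type*} [NormedAddCommGroup W] [NormedSpace ℂ W] {m : ℕ} {S : Set (ℙ ℂ W)}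

/-- The point `e_0 + x^s e_s + y e_{n+1}`. -/
def framePoint (e : Fin (2 * m + 2) → W) (x : Fin (2 * m) → ℝ) (y : ℝ) : W :=
  e 0 + ∑ s, x s • e (idx s) + y • e (Fin.last _)

@[simp] theorem framePoint_zero (e : Fin (2 * m + 2) → W) : framePoint e 0 0 = e 0 := by
  simp [framePoint]

theorem contDiff_framePoint : ContDiff ℝ ∞
    fun q : ((Fin (2 * m + 2) → W) × (Fin (2 * m) → ℝ)) × ℝ => framePoint q.1.1 q.1.2 q.2 := by
  unfold framePoint
  fun_prop

theorem hasDerivAt_framePoint {e : ℝ → Fin (2 * m + 2) → W} {x : ℝ → Fin (2 * m) → ℝ} {y : ℝ → ℝ}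
    {ξ : Fin (2 * m + 2) → W} {u : Fin (2 * m) → ℝ} {z τ : ℝ} (he : HasDerivAt e ξ τ)
    (hx : HasDerivAt x u τ) (hy : HasDerivAt y z τ) :
    HasDerivAt (fun τ => framePoint (e τ) (x τ) (y τ))
      (framePoint ξ (x τ) (y τ) + ∑ s, u s • e τ (idx s) + z • e τ (Fin.last _)) τ := by
  rw [hasDerivAt_pi] at he hx
  have h1 := ((he 0).add (HasDerivAt.fun_sum (u := Finset.univ) fun s _ =>
    (hx s).smul (he (idx s)))).add (hy.smul (he (Fin.last _)))
  refine h1.congr_deriv ?_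
  simp only [framePoint, Finset.sum_add_distrib]
  abel

/-- `Φ` describes the cone over `S` as a graph, near the point `e_0` and in all frames near a
given one, by means of the local equation `ρ`. -/
structure IsGraph (S : Set (ℙ ℂ W)) (U : Set W) (ρ : W → ℝ)
    (O : Set ((Fin (2 * m + 2) → W) × (Fin (2 * m) → ℝ)))
    (Φ : (Fin (2 * m + 2) → W) × (Fin (2 * m) → ℝ) → ℝ) : Prop where
  equation : IsLocalEquation S U ρ
  isOpen : IsOpen O
  smooth : ContDiffOn ℝ ∞ Φ O
  mem : ∀ q ∈ O, framePoint q.1 q.2 (Φ q) ∈ U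
  zero : ∀ q ∈ O, ρ (framePoint q.1 q.2 (Φ q)) = 0
  ne_zero : ∀ q ∈ O, fderiv ℝ ρ (framePoint q.1 q.2 (Φ q)) (q.1 (Fin.last _)) ≠ 0

/-- The implicit function theorem is applied with the whole tuple `e` as parameter, not constrained
to be a frame. So `Φ` lives on an open set and can be differentiated in ambient directions.
Solvability for `y` is `dρ(e_{n+1}) ≠ 0`. -/
theorem exists_isGraph [FiniteDimensional ℂ W] (hS : IsCRHypersurface S)
    {e : Fin (2 * m + 2) → W} (he : e ∈ adaptedFrames m S) :
    ∃ U ρ O Φ, IsGraph S U ρ O Φ ∧ (e, (0 : Fin (2 * m) → ℝ)) ∈ O ∧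
      ∀ᶠ q in 𝓝 ((e, (0 : Fin (2 * m) → ℝ)), (0 : ℝ)),
        framePoint q.1.1 q.1.2 q.2 ∈ cone S → q.2 = Φ q.1 := by
  have : FiniteDimensional ℝ W := FiniteDimensional.complexToReal W
  have : CompleteSpace W := FiniteDimensional.complete ℝ W
  obtain ⟨U, ρ, h, hU, hd⟩ := hS.exists_isLocalEquation he.2.1
  have hN := fderiv_last_ne_zero he h hU hd
  let L : ((Fin (2 * m + 2) → W) × (Fin (2 * m) → ℝ)) × ℝ → W :=
    fun q => framePoint q.1.1 q.1.2 q.2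
  have hL : ContDiff ℝ ∞ L := contDiff_framePoint
  have hL0 : L ((e, 0), 0) = e 0 := framePoint_zero e
  have hΩ : IsOpen (L ⁻¹' U) := h.isOpen.preimage hL.continuous
  have hG : ContDiffOn ℝ ∞ (ρ ∘ L) (L ⁻¹' U) := h.smooth.comp hL.contDiffOn fun _ h => h
  have hu0 : ((e, 0), 0) ∈ L ⁻¹' U := by rw [Set.mem_preimage, hL0]; exact hU
  have hder : ∀ q ∈ L ⁻¹' U, fderiv ℝ (ρ ∘ L) q (0, 1) =
      fderiv ℝ ρ (L q) (q.1.1 (Fin.last _)) := by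
    intro q hq
    have h1 : HasDerivAt (fun τ : ℝ => (q.1, τ)) (0, 1) q.2 :=
      (hasDerivAt_const _ _).prodMk (hasDerivAt_id _)
    have h2 := (differentiableAt_of_contDiffOn hΩ hG hq).hasFDerivAt.comp_hasDerivAt
      (f := fun τ : ℝ => (q.1, τ)) q.2 h1
    have h3 := hasDerivAt_framePoint (hasDerivAt_const q.2 q.1.1) (hasDerivAt_const q.2 q.1.2)
      (hasDerivAt_id q.2)
    have h4 := HasFDerivAt.comp_hasDerivAt (l := ρ) (f := fun τ => L (q.1, τ)) q.2
      (differentiableAt_of_contDiffOn h.isOpen h.smooth hq).hasFDerivAt h3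
    rw [h2.unique h4]
    simp [framePoint]
  obtain ⟨O, Φ, hO, h0O, hΦ, hΦ0, hzero, huniq⟩ := exists_implicit hΩ hG hu0
    (by rw [Function.comp_apply, hL0]; exact (h.mem_cone_iff _ hU).1 he.2.1)
    (by rw [hder _ hu0, hL0]; exact hN)
  refine ⟨U, ρ, O, Φ, ⟨h, hO, hΦ, fun q hq => (hzero q hq).1, fun q hq => (hzero q hq).2.1,
    fun q hq => ?_⟩, h0O, ?_⟩
  · have := (hzero q hq).2.2
    rwa [hder _ (hzero q hq).1] at this
  · filter_upwards [huniq, hΩ.mem_nhds hu0] with q h1 h2 h3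
    exact h1 ((h.mem_cone_iff _ h2).1 h3)

theorem sum_univ_frame {M : Type*} [AddCommMonoid M] (f : Fin (2 * m + 2) → M) :
    ∑ j, f j = f 0 + ∑ s : Fin (2 * m), f (idx s) + f (Fin.last _) := by
  rw [Fin.sum_univ_castSucc, Fin.sum_univ_succ]
  rfl

namespace IsGraph

variable {U : Set W} {ρ : W → ℝ} {O : Set ((Fin (2 * m + 2) → W) × (Fin (2 * m) → ℝ))}
  {Φ : (Fin (2 * m + 2) → W) × (Fin (2 * m) → ℝ) → ℝ} (h : IsGraph S U ρ O Φ)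
include h

/-- The chain rule for the identity `ρ = 0` on the graph, along the line through `q` with velocity
`(ξ, u)`. All relations between `dΦ` and `dρ` are special cases. -/
theorem fderiv_eq {q : (Fin (2 * m + 2) → W) × (Fin (2 * m) → ℝ)} (hq : q ∈ O)
    (ξ : Fin (2 * m + 2) → W) (u : Fin (2 * m) → ℝ) :
    fderiv ℝ ρ (framePoint q.1 q.2 (Φ q)) (framePoint ξ q.2 (Φ q) + ∑ s, u s • q.1 (idx s)
      + fderiv ℝ Φ q (ξ, u) • q.1 (Fin.last _)) = 0 := by
  have h1 : HasDerivAt (fun τ : ℝ => q.1 + τ • ξ) ξ 0 := by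
    simpa using ((hasDerivAt_id (0 : ℝ)).smul_const ξ).const_add q.1
  have h2 : HasDerivAt (fun τ : ℝ => q.2 + τ • u) u 0 := by
    simpa using ((hasDerivAt_id (0 : ℝ)).smul_const u).const_add q.2
  have h12 := h1.prodMk h2
  have h0 : (q.1 + (0 : ℝ) • ξ, q.2 + (0 : ℝ) • u) = q := by simp
  have h3 := HasFDerivAt.comp_hasDerivAt (l := Φ) (f := fun τ : ℝ => (q.1 + τ • ξ, q.2 + τ • u))
    (l' := fderiv ℝ Φ q) 0
    (by
      simp only [h0]
      exact (differentiableAt_of_contDiffOn h.isOpen h.smooth hq).hasFDerivAt) h12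
  have h4 := hasDerivAt_framePoint h1 h2 h3
  have h5 := HasFDerivAt.comp_hasDerivAt (l := ρ) (l' := fderiv ℝ ρ (framePoint q.1 q.2 (Φ q)))
    0 (by
      simp only [Function.comp_apply, zero_smul, add_zero]
      exact (differentiableAt_of_contDiffOn h.equation.isOpen h.equation.smooth
        (h.mem q hq)).hasFDerivAt) h4
  simp only [Function.comp_apply, zero_smul, add_zero] at h5
  have h6 : (ρ ∘ fun τ : ℝ => framePoint (q.1 + τ • ξ) (q.2 + τ • u)
      ((Φ ∘ fun τ : ℝ => (q.1 + τ • ξ, q.2 + τ • u)) τ)) =ᶠ[𝓝 0] fun _ => 0 := by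
    have : ∀ᶠ τ in 𝓝 (0 : ℝ), (q.1 + τ • ξ, q.2 + τ • u) ∈ O :=
      h12.continuousAt.eventually (h.isOpen.mem_nhds (by simp only [h0]; exact hq))
    filter_upwards [this] with τ hτ
    exact h.zero _ hτ
  exact h5.unique ((hasDerivAt_const (0 : ℝ) (0 : ℝ)).congr_of_eventuallyEq h6)

theorem fderiv_frame {q : (Fin (2 * m + 2) → W) × (Fin (2 * m) → ℝ)} (hq : q ∈ O)
    (s : Fin (2 * m)) :
    fderiv ℝ ρ (framePoint q.1 q.2 (Φ q)) (q.1 (idx s)) =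
      -fderiv ℝ Φ q (0, unitVec s) * fderiv ℝ ρ (framePoint q.1 q.2 (Φ q)) (q.1 (Fin.last _)) := by
  have h1 := h.fderiv_eq hq 0 (unitVec s)
  have h2 : framePoint (0 : Fin (2 * m + 2) → W) q.2 (Φ q) = 0 := by simp [framePoint]
  have h3 : ∑ t, unitVec s t • q.1 (idx t) = q.1 (idx s) := by
    rw [Finset.sum_eq_single s] <;> simp +contextual
  rw [h2, h3, zero_add, map_add, map_smul, smul_eq_mul] at h1
  linarith

theorem mem_cone {q : (Fin (2 * m + 2) → W) × (Fin (2 * m) → ℝ)} (hq : q ∈ O) :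
    framePoint q.1 q.2 (Φ q) ∈ cone S :=
  (h.equation.mem_cone_iff _ (h.mem q hq)).2 (h.zero q hq)

/-- The variation of the graph when the frame moves with velocity `ξ`. -/
theorem fderiv_frame_direction {e : Fin (2 * m + 2) → W} {x : Fin (2 * m) → ℝ} (hq : (e, x) ∈ O)
    (he : IsFrame m e) (ξ : Fin (2 * m + 2) → W) :
    let w := he.omega ξ
    let N := Fin.last (2 * m + 1)
    let f := Φ (e, x)
    let df := fun t => fderiv ℝ Φ (e, x) (0, unitVec t)
    let g := f - ∑ t, x t * df t
    fderiv ℝ Φ (e, x) (ξ, 0) =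
      -(w N 0 + ∑ s, w N (idx s) * x s + w N N * f)
      + ∑ t, (w (idx t) 0 * df t + df t * ∑ s, w (idx t) (idx s) * x s + w (idx t) N * (df t * f))
      + (w 0 0 * g + g * ∑ s, w 0 (idx s) * x s + w 0 N * (g * f)) := by
  intro w N f df g
  set lam := fderiv ℝ ρ (framePoint e x f) with hlam
  set a := lam (e N) with ha
  have ha0 : a ≠ 0 := h.ne_zero _ hq
  have hs : ∀ s, lam (e (idx s)) = -df s * a := h.fderiv_frame hq
  -- The point of the graph is itself a tangent vector, since the cone is invariant under scaling;
  -- expanding it in the frame solves for `dρ(e_0)`.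
  have h0 : lam (e 0) = -g * a := by
    have h1 : lam ((1 : ℂ) • framePoint e x f) = 0 :=
      h.equation.fderiv_eq_zero (h.mem _ hq) (smul_mem_tangentVectors (h.mem_cone hq) 1)
    rw [one_smul, framePoint, map_add, map_add, map_sum, map_smul, smul_eq_mul] at h1
    simp only [map_smul, smul_eq_mul, hs] at h1
    have h2 : ∑ s, x s * (-df s * a) = -(∑ s, x s * df s) * a := by
      rw [← Finset.sum_neg_distrib, Finset.sum_mul]
      exact Finset.sum_congr rfl fun s _ => by ring
    rw [h2] at h1
    simp only [g]
    linear_combination h1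
  have hk : ∀ k, lam (ξ k) = (w N k - ∑ t, df t * w (idx t) k - g * w 0 k) * a := by
    intro k
    rw [← he.sum_omega ξ k, sum_univ_frame, map_add, map_add, map_sum]
    simp only [map_smul, smul_eq_mul, hs, h0]
    have h2 : ∑ t, w (idx t) k * (-df t * a) = -(∑ t, df t * w (idx t) k) * a := by
      rw [← Finset.sum_neg_distrib, Finset.sum_mul]
      exact Finset.sum_congr rfl fun s _ => by ring
    change w 0 k * _ + ∑ t, w (idx t) k * (-df t * a) + w N k * a = _
    rw [h2]
    ring
  have h1 := h.fderiv_eq hq ξ 0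
  simp only [Pi.zero_apply, zero_smul, Finset.sum_const_zero, add_zero] at h1
  change lam (framePoint ξ x f + fderiv ℝ Φ (e, x) (ξ, 0) • e N) = 0 at h1
  rw [framePoint, map_add, map_add, map_add, map_sum, map_smul, map_smul, smul_eq_mul,
    smul_eq_mul] at h1
  simp only [map_smul, smul_eq_mul, hk] at h1
  have h2 : fderiv ℝ Φ (e, x) (ξ, 0) = -((w N 0 - ∑ t, df t * w (idx t) 0 - g * w 0 0)
      + ∑ s, x s * (w N (idx s) - ∑ t, df t * w (idx t) (idx s) - g * w 0 (idx s))
      + f * (w N N - ∑ t, df t * w (idx t) N - g * w 0 N)) := by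
    apply mul_right_cancel₀ ha0
    have h3 : ∑ s, x s * ((w N (idx s) - ∑ t, df t * w (idx t) (idx s) - g * w 0 (idx s)) * a) =
        (∑ s, x s * (w N (idx s) - ∑ t, df t * w (idx t) (idx s) - g * w 0 (idx s))) * a := by
      rw [Finset.sum_mul]
      exact Finset.sum_congr rfl fun s _ => by ring
    rw [h3] at h1
    linear_combination h1
  rw [h2]
  have h4 : ∑ s, x s * (w N (idx s) - ∑ t, df t * w (idx t) (idx s) - g * w 0 (idx s)) =
      ∑ s, w N (idx s) * x s - ∑ t, df t * ∑ s, w (idx t) (idx s) * x s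
        - g * ∑ s, w 0 (idx s) * x s := by
    simp only [mul_sub, Finset.sum_sub_distrib, Finset.mul_sum]
    rw [Finset.sum_comm]
    congr 1
    · congr 1
      · exact Finset.sum_congr rfl fun s _ => by ring
      · exact Finset.sum_congr rfl fun s _ => Finset.sum_congr rfl fun t _ => by ring
    · exact Finset.sum_congr rfl fun s _ => by ring
  have h5 : ∑ t, (w (idx t) 0 * df t + df t * ∑ s, w (idx t) (idx s) * x s
      + w (idx t) N * (df t * f)) = ∑ t, df t * w (idx t) 0
      + ∑ t, df t * ∑ s, w (idx t) (idx s) * x s + f * ∑ t, df t * w (idx t) N := by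
    rw [Finset.mul_sum, ← Finset.sum_add_distrib, ← Finset.sum_add_distrib]
    exact Finset.sum_congr rfl fun s _ => by ring
  rw [h4, h5]
  ring

end IsGraph

/-- The germ at `0` of the function whose graph is the cone over `S`, in the frame `e`. -/
def graphAt (S : Set (ℙ ℂ W)) (e : Fin (2 * m + 2) → W) : (Fin (2 * m) → ℝ) → ℝ :=
  open Classical in
  if h : ∃ φ : (Fin (2 * m) → ℝ) → ℝ, ContinuousAt φ 0 ∧ φ 0 = 0 ∧
    ∀ᶠ x in 𝓝 0, framePoint e x (φ x) ∈ cone S then h.choose else 0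

/-- The invariants `h_{s_1 … s_p}`: the Taylor coefficients of the graph. -/
def taylorCoeff (S : Set (ℙ ℂ W)) (l : List (Fin (2 * m))) (e : Fin (2 * m + 2) → W) : ℝ :=
  iterD unitVec l (graphAt S e) 0

/-- `graphAt` chooses any continuous function through `0` with graph in the cone; continuity keeps
its graph in the region where `Φ` is the only solution, so its germ is that of `Φ(e', ·)`. The
uniqueness region is open, so one `Φ` serves all adapted frames near `e`, which makes the pointwise
choice smooth in the frame. -/
theorem IsGraph.eventually_graphAt {U : Set W} {ρ : W → ℝ}
    {O : Set ((Fin (2 * m + 2) → W) × (Fin (2 * m) → ℝ))}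
    {Φ : (Fin (2 * m + 2) → W) × (Fin (2 * m) → ℝ) → ℝ} (h : IsGraph S U ρ O Φ)
    {e : Fin (2 * m + 2) → W} (heO : (e, (0 : Fin (2 * m) → ℝ)) ∈ O)
    (huniq : ∀ᶠ q in 𝓝 ((e, (0 : Fin (2 * m) → ℝ)), (0 : ℝ)),
        framePoint q.1.1 q.1.2 q.2 ∈ cone S → q.2 = Φ q.1) :
    ∀ᶠ e' in 𝓝 e, (e', (0 : Fin (2 * m) → ℝ)) ∈ O ∧ (e' ∈ adaptedFrames m S →
      Φ (e', 0) = 0 ∧ graphAt S e' =ᶠ[𝓝 0] fun x => Φ (e', x)) := by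
  have h1 : ∀ᶠ e' in 𝓝 e, (e', (0 : Fin (2 * m) → ℝ)) ∈ O :=
    (by fun_prop : ContinuousAt (fun e' : Fin (2 * m + 2) → W =>
      (e', (0 : Fin (2 * m) → ℝ))) e).eventually (h.isOpen.mem_nhds heO)
  have h2 : ∀ᶠ e' in 𝓝 e, ∀ᶠ q in 𝓝 ((e', (0 : Fin (2 * m) → ℝ)), (0 : ℝ)),
      framePoint q.1.1 q.1.2 q.2 ∈ cone S → q.2 = Φ q.1 :=
    (by fun_prop : ContinuousAt (fun e' : Fin (2 * m + 2) → W =>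
      ((e', (0 : Fin (2 * m) → ℝ)), (0 : ℝ))) e).eventually (eventually_eventually_nhds.2 huniq)
  filter_upwards [h1, h2] with e' hO hq
  refine ⟨hO, fun he' => ?_⟩
  have h0 : Φ (e', 0) = 0 :=
    (hq.self_of_nhds (by rw [framePoint_zero]; exact he'.2.1)).symm
  have hO' : IsOpen {x : Fin (2 * m) → ℝ | (e', x) ∈ O} := h.isOpen.preimage (by fun_prop)
  have hex : ∃ φ : (Fin (2 * m) → ℝ) → ℝ, ContinuousAt φ 0 ∧ φ 0 = 0 ∧
      ∀ᶠ x in 𝓝 0, framePoint e' x (φ x) ∈ cone S := by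
    refine ⟨fun x => Φ (e', x), ?_, h0, ?_⟩
    · exact ContinuousAt.comp (f := fun x => (e', x))
        (h.smooth.continuousOn.continuousAt (h.isOpen.mem_nhds hO)) (by fun_prop)
    · filter_upwards [hO'.mem_nhds hO] with x hx
      exact h.mem_cone hx
  refine ⟨h0, ?_⟩
  obtain ⟨hc, hφ0, hφ⟩ := hex.choose_spec
  have hg : graphAt S e' = hex.choose := dif_pos hex
  rw [← hg] at hc hφ0 hφ
  have hcont : ContinuousAt (fun x => ((e', x), graphAt S e' x)) 0 := by fun_prop
  have hlim := hcont.eventually (p := fun q =>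
    framePoint q.1.1 q.1.2 q.2 ∈ cone S → q.2 = Φ q.1) (by simp only [hφ0]; exact hq)
  filter_upwards [hlim, hφ] with x h3 h4
  exact h3 h4

end Graph

/-! ### The Taylor coefficients satisfy the structure equations -/

section JetFormula

variable {ι : Type*} [Fintype ι]

/-- The linear form with coefficients `a`. -/
def linForm (a : ι → ℝ) : (ι → ℝ) →L[ℝ] ℝ := ∑ s, a s • ContinuousLinearMap.proj s

theorem linForm_apply (a x : ι → ℝ) : linForm a x = ∑ s, a s * x s := by
  simp [linForm]

variable [DecidableEq ι]

theorem iterD_linForm (a : ι → ℝ) (l : List ι) :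
    iterD unitVec l (linForm a) 0 = covector a l := by
  rw [iterD_clm _ _ _ (map_zero _)]
  congr 1
  ext s
  simp [linForm_apply, Pi.single_apply]

/-- The partial derivatives at `0` of the variation of a graph `f`, in terms of those of `f`. -/
theorem iterD_variation {O : Set (ι → ℝ)} (hO : IsOpen O) (h0 : (0 : ι → ℝ) ∈ O)
    {f g : (ι → ℝ) → ℝ} (hf : ContDiffOn ℝ ∞ f O) (r q c0 cN : ℝ) (a b0 bN c : ι → ℝ)
    (b : ι → ι → ℝ)
    (hg : ∀ x ∈ O, let df := fun t => fderiv ℝ f x (unitVec t)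
      let k := f x - ∑ t, x t * df t
      g x = -(r + ∑ s, a s * x s + q * f x)
        + ∑ t, (b0 t * df t + df t * ∑ s, b t s * x s + bN t * (df t * f x))
        + (c0 * k + k * ∑ s, c s * x s + cN * (k * f x)))
    (l : List ι) (hl : l ≠ []) :
    let H := fun l => iterD unitVec l f 0
    let K := fun l : List ι => (1 - l.length : ℝ) * H l
    iterD unitVec l g 0 = -(covector a l + q * H l)
      + ∑ t, (b0 t * H (t :: l) + leib (fun l => H (t :: l)) (covector (b t)) l
        + bN t * leib (fun l => H (t :: l)) H l)
      + (c0 * K l + leib K (covector c) l + cN * leib K H l) := by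
  intro H K
  have hdf : ∀ t, ContDiffOn ℝ ∞ (fun x => fderiv ℝ f x (unitVec t)) O := fun t =>
    contDiffOn_dirD hO hf _
  have hlin : ∀ a : ι → ℝ, ContDiffOn ℝ ∞ (fun x => linForm a x) O := fun a =>
    (linForm a).contDiff.contDiffOn
  have hE : ContDiffOn ℝ ∞ (fun x : ι → ℝ => ∑ t, x t * fderiv ℝ f x (unitVec t)) O :=
    ContDiffOn.sum fun t _ => (by fun_prop : ContDiffOn ℝ ∞ (fun x : ι → ℝ => x t) O).mul (hdf t)
  -- The coefficient that multiplies the `ω^0` terms; by `iterD_euler` its derivatives at `0` are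
  -- those of `f` times `1 - p`.
  let k : (ι → ℝ) → ℝ := fun x => f x + -1 * ∑ t, x t * fderiv ℝ f x (unitVec t)
  have hk : ContDiffOn ℝ ∞ k O := hf.add (contDiffOn_const.mul hE)
  have hkD : (fun l => iterD unitVec l k 0) = K := by
    funext l
    simp only [k, K]
    rw [iterD_add hO hf (contDiffOn_const.mul hE) l h0]
    simp only
    rw [iterD_const_mul hO hE _ l h0]
    simp only
    rw [iterD_euler hO hf l h0]
    simp only [Pi.zero_apply, zero_mul, Finset.sum_const_zero, H]
    ring
  have hg' : Set.EqOn g (fun x => (-r + (-1 * linForm a x + -q * f x))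
      + (∑ t, (b0 t * fderiv ℝ f x (unitVec t) + (fderiv ℝ f x (unitVec t) * linForm (b t) x
          + bN t * (fderiv ℝ f x (unitVec t) * f x)))
        + (c0 * k x + (k x * linForm c x + cN * (k x * f x))))) O := by
    intro x hx
    rw [hg x hx]
    simp only [linForm_apply, k, ← add_assoc]
    ring
  have c1 : ContDiffOn ℝ ∞ (fun x => -1 * linForm a x) O := contDiffOn_const.mul (hlin a)
  have c2 : ContDiffOn ℝ ∞ (fun x => -q * f x) O := contDiffOn_const.mul hf
  have c3 : ∀ t, ContDiffOn ℝ ∞ (fun x => b0 t * fderiv ℝ f x (unitVec t)) O := fun t =>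
    contDiffOn_const.mul (hdf t)
  have c4 : ∀ t, ContDiffOn ℝ ∞ (fun x => fderiv ℝ f x (unitVec t) * linForm (b t) x) O :=
    fun t => (hdf t).mul (hlin _)
  have c5 : ∀ t, ContDiffOn ℝ ∞ (fun x => fderiv ℝ f x (unitVec t) * f x) O :=
    fun t => (hdf t).mul hf
  have c6 : ∀ t, ContDiffOn ℝ ∞ (fun x => bN t * (fderiv ℝ f x (unitVec t) * f x)) O :=
    fun t => contDiffOn_const.mul (c5 t)
  have c7 : ContDiffOn ℝ ∞ (fun x => c0 * k x) O := contDiffOn_const.mul hk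
  have c8 : ContDiffOn ℝ ∞ (fun x => k x * linForm c x) O := hk.mul (hlin c)
  have c9 : ContDiffOn ℝ ∞ (fun x => k x * f x) O := hk.mul hf
  have c10 : ContDiffOn ℝ ∞ (fun x => cN * (k x * f x)) O := contDiffOn_const.mul c9
  have cr : ContDiffOn ℝ ∞ (fun _ : ι → ℝ => -r) O := contDiffOn_const
  have add : ∀ {F G : (ι → ℝ) → ℝ}, ContDiffOn ℝ ∞ F O → ContDiffOn ℝ ∞ G O →
      iterD unitVec l (fun x => F x + G x) 0 = iterD unitVec l F 0 + iterD unitVec l G 0 :=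
    fun hF hG => iterD_add hO hF hG l h0
  have cmul : ∀ {F : (ι → ℝ) → ℝ} (c : ℝ), ContDiffOn ℝ ∞ F O →
      iterD unitVec l (fun x => c * F x) 0 = c * iterD unitVec l F 0 :=
    fun c hF => iterD_const_mul hO hF c l h0
  have mul : ∀ {F G : (ι → ℝ) → ℝ}, ContDiffOn ℝ ∞ F O → ContDiffOn ℝ ∞ G O →
      iterD unitVec l (fun x => F x * G x) 0 =
        leib (fun k => iterD unitVec k F 0) (fun k => iterD unitVec k G 0) l :=
    fun hF hG => iterD_mul hO hF hG l h0
  have hcov : ∀ a : ι → ℝ, (fun k => iterD unitVec k (fun x => linForm a x) 0) = covector a :=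
    fun a => funext fun k => iterD_linForm a k
  rw [iterD_congr hO hg' l h0, add (cr.add (c1.add c2)) ((ContDiffOn.sum fun t _ =>
    (c3 t).add ((c4 t).add (c6 t))).add (c7.add (c8.add c10))), add cr (c1.add c2), add c1 c2,
    add (ContDiffOn.sum fun t _ => (c3 t).add ((c4 t).add (c6 t))) (c7.add (c8.add c10)),
    add c7 (c8.add c10), add c8 c10, cmul _ (hlin a), cmul _ hf, cmul _ hk, mul hk (hlin c),
    cmul _ c9, mul hk hf, iterD_const, if_neg hl,
    iterD_sum _ hO (fun t _ => (c3 t).add ((c4 t).add (c6 t))) l h0]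
  have ht : ∀ t, iterD unitVec l (fun x => b0 t * fderiv ℝ f x (unitVec t)
      + (fderiv ℝ f x (unitVec t) * linForm (b t) x
      + bN t * (fderiv ℝ f x (unitVec t) * f x))) 0 =
      b0 t * H (t :: l) + leib (fun l => H (t :: l)) (covector (b t)) l
        + bN t * leib (fun l => H (t :: l)) H l := by
    intro t
    rw [add (c3 t) ((c4 t).add (c6 t)), add (c4 t) (c6 t), cmul _ (hdf t),
      mul (hdf t) (hlin _), cmul _ (c5 t), mul (hdf t) hf, hcov, ← add_assoc]
    rfl
  simp only [ht, hkD, hcov]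
  have hca : iterD unitVec l (fun x => linForm a x) 0 = covector a l := congrFun (hcov a) l
  rw [hca, congrFun hkD l]
  ring

end JetFormula

section Existence

variable {W : Type*} [NormedAddCommGroup W] [NormedSpace ℂ W] {m : ℕ} {S : Set (ℙ ℂ W)}

/-- Near every adapted frame, the Taylor coefficients are the partial derivatives of a smooth
function of the frame and the point. -/
theorem exists_taylorCoeff_eq [FiniteDimensional ℂ W] (hS : IsCRHypersurface S)
    {e : Fin (2 * m + 2) → W} (he : e ∈ adaptedFrames m S) :
    ∃ U ρ O Φ, IsGraph S U ρ O Φ ∧ ∀ᶠ e' in 𝓝 e, (e', (0 : Fin (2 * m) → ℝ)) ∈ O ∧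
      (e' ∈ adaptedFrames m S → Φ (e', 0) = 0 ∧ ∀ l, taylorCoeff S l e' =
        iterD (fun s => ((0 : Fin (2 * m + 2) → W), unitVec s)) l Φ (e', 0)) := by
  obtain ⟨U, ρ, O, Φ, h, heO, huniq⟩ := exists_isGraph hS he
  refine ⟨U, ρ, O, Φ, h, ?_⟩
  filter_upwards [h.eventually_graphAt heO huniq] with e' he'
  refine ⟨he'.1, fun hF => ⟨(he'.2 hF).1, fun l => ?_⟩⟩
  rw [taylorCoeff, iterD_congr_of_eventuallyEq (he'.2 hF).2, iterD_slice h.isOpen h.smooth l he'.1]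

theorem contDiffOn_taylorCoeff [FiniteDimensional ℂ W] (hS : IsCRHypersurface S)
    (l : List (Fin (2 * m))) : ContDiffOn ℝ ∞ (taylorCoeff S l) (adaptedFrames m S) := by
  intro e he
  obtain ⟨U, ρ, O, Φ, h, hev⟩ := exists_taylorCoeff_eq hS he
  have h1 : ContDiffAt ℝ ∞ (fun e' => iterD
      (fun s => ((0 : Fin (2 * m + 2) → W), unitVec s)) l Φ (e', 0)) e :=
    ContDiffAt.comp (f := fun e' => (e', (0 : Fin (2 * m) → ℝ))) e
      ((contDiffOn_iterD h.isOpen h.smooth l).contDiffAt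
        (h.isOpen.mem_nhds hev.self_of_nhds.1)) (by fun_prop)
  refine h1.contDiffWithinAt.congr_of_eventuallyEq ?_ ((hev.self_of_nhds.2 he).2 l)
  filter_upwards [mem_nhdsWithin_of_mem_nhds hev, self_mem_nhdsWithin] with e' h2 h3
  exact (h2.2 h3).2 l

theorem taylorCoeff_perm [FiniteDimensional ℂ W] (hS : IsCRHypersurface S)
    {l l' : List (Fin (2 * m))} (hl : l.Perm l') {e : Fin (2 * m + 2) → W}
    (he : e ∈ adaptedFrames m S) : taylorCoeff S l e = taylorCoeff S l' e := by
  obtain ⟨U, ρ, O, Φ, h, hev⟩ := exists_taylorCoeff_eq hS he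
  obtain ⟨h1, h2⟩ := hev.self_of_nhds
  rw [(h2 he).2, (h2 he).2, iterD_perm h.isOpen h.smooth hl h1]

theorem taylorCoeff_nil [FiniteDimensional ℂ W] (hS : IsCRHypersurface S)
    {e : Fin (2 * m + 2) → W} (he : e ∈ adaptedFrames m S) : taylorCoeff S [] e = 0 := by
  obtain ⟨U, ρ, O, Φ, h, hev⟩ := exists_taylorCoeff_eq hS he
  obtain ⟨h1, h2⟩ := hev.self_of_nhds
  rw [(h2 he).2, iterD, (h2 he).1]

/-- At `x = 0`, `dρ(e_s) = -∂_s Φ · dρ(e_{n+1})`. The left side is zero by tangency of `e_s`, and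
`dρ(e_{n+1})` is not. -/
theorem taylorCoeff_singleton [FiniteDimensional ℂ W] (hS : IsCRHypersurface S)
    (s : Fin (2 * m)) {e : Fin (2 * m + 2) → W} (he : e ∈ adaptedFrames m S) :
    taylorCoeff S [s] e = 0 := by
  obtain ⟨U, ρ, O, Φ, h, hev⟩ := exists_taylorCoeff_eq hS he
  obtain ⟨h1, h2⟩ := hev.self_of_nhds
  obtain ⟨h3, h4⟩ := h2 he
  have h5 := h.fderiv_frame h1 s
  have h6 := h.ne_zero _ h1
  have h7 := h.mem _ h1
  simp only [h3, framePoint_zero] at h5 h6 h7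
  have h8 : fderiv ℝ ρ (e 0) (e (idx s)) = 0 :=
    h.equation.fderiv_eq_zero h7 (castSucc_mem_tangentVectors he s.succ)
  rw [h8] at h5
  rw [h4]
  simpa [iterD, h6] using h5.symm

/-- Along a curve of adapted frames the Taylor coefficient coincides with a partial derivative of
`Φ`, whose ambient derivative can be computed. Commuting the frame derivative past the partial
derivatives reduces the claim to `iterD_variation`. -/
theorem differential_taylorCoeff [FiniteDimensional ℂ W] (hS : IsCRHypersurface S)
    {e ξ : Fin (2 * m + 2) → W} (he : e ∈ adaptedFrames m S)
    (hξ : ξ ∈ tangentVectors (adaptedFrames m S) e) (l : List (Fin (2 * m))) (hl : l ≠ []) :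
    let w := he.1.omega ξ
    let N := Fin.last (2 * m + 1)
    let H := fun l => taylorCoeff S l e
    let K := fun l : List (Fin (2 * m)) => (1 - l.length : ℝ) * H l
    differential (adaptedFrames m S) (taylorCoeff S l) e ξ =
      -(covector (fun s => w N (idx s)) l + w N N * H l)
      + ∑ t, (w (idx t) 0 * H (t :: l)
        + leib (fun l => H (t :: l)) (covector fun s => w (idx t) (idx s)) l
        + w (idx t) N * leib (fun l => H (t :: l)) H l)
      + (w 0 0 * K l + leib K (covector fun s => w 0 (idx s)) l + w 0 N * leib K H l) := by
  intro w N H K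
  obtain ⟨U, ρ, O, Φ, h, hev⟩ := exists_taylorCoeff_eq hS he
  obtain ⟨heO, h2⟩ := hev.self_of_nhds
  obtain ⟨c, -, hc0, hcF, hcd⟩ := hξ
  have hd := hasDerivAt_comp_curve (contDiffOn_taylorCoeff hS l) hc0 hcF hcd
  have hsm := contDiffOn_iterD (b := fun s => ((0 : Fin (2 * m + 2) → W), unitVec s))
    h.isOpen h.smooth l
  have hd' : HasDerivAt (fun τ => iterD (fun s => ((0 : Fin (2 * m + 2) → W), unitVec s)) l Φ
      (c τ, 0)) (fderiv ℝ (iterD (fun s => ((0 : Fin (2 * m + 2) → W), unitVec s)) l Φ)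
        (e, 0) (ξ, 0)) 0 := by
    refine HasFDerivAt.comp_hasDerivAt (f := fun τ => (c τ, (0 : Fin (2 * m) → ℝ))) 0 ?_
      (hcd.prodMk (hasDerivAt_const _ _))
    simp only [hc0]
    exact (differentiableAt_of_contDiffOn h.isOpen hsm heO).hasFDerivAt
  have heq : (fun τ => taylorCoeff S l (c τ)) =ᶠ[𝓝 0]
      fun τ => iterD (fun s => ((0 : Fin (2 * m + 2) → W), unitVec s)) l Φ (c τ, 0) := by
    have h3 := hcd.continuousAt.eventually (p := fun e' => _) (by rw [hc0]; exact hev)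
    filter_upwards [h3, hcF] with τ h4 h5
    exact (h4.2 h5).2 l
  rw [hd.unique (hd'.congr_of_eventuallyEq heq)]
  refine (dirD_iterD h.isOpen h.smooth (ξ, 0) l heO).trans ?_
  rw [iterD_slice h.isOpen (contDiffOn_dirD h.isOpen h.smooth _) l heO]
  have hO' : IsOpen {x : Fin (2 * m) → ℝ | (e, x) ∈ O} := h.isOpen.preimage (by fun_prop)
  have hf : ContDiffOn ℝ ∞ (fun x => Φ (e, x)) {x : Fin (2 * m) → ℝ | (e, x) ∈ O} :=
    h.smooth.comp (by fun_prop) fun x hx => hx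
  have hH : ∀ k, H k = iterD unitVec k (fun x => Φ (e, x)) 0 := by
    intro k
    simp only [H]
    rw [(h2 he).2, iterD_slice h.isOpen h.smooth k heO]
  have hpart : ∀ x : Fin (2 * m) → ℝ, (e, x) ∈ O → ∀ t,
      fderiv ℝ (fun y => Φ (e, y)) x (unitVec t) = fderiv ℝ Φ (e, x) (0, unitVec t) := by
    intro x hx t
    exact (iterD_slice h.isOpen h.smooth [t] hx).symm
  have key := iterD_variation hO' heO hf (g := fun x => fderiv ℝ Φ (e, x) (ξ, 0))
    (w N 0) (w N N) (w 0 0) (w 0 N) (fun s => w N (idx s)) (fun t => w (idx t) 0)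
    (fun t => w (idx t) N) (fun s => w 0 (idx s)) (fun t s => w (idx t) (idx s))
    (fun x hx => by
      simp only [hpart x hx]
      exact h.fderiv_frame_direction hx he.1 ξ) l hl
  simp only [← hH] at key
  exact key

theorem isInvariantSystem_taylorCoeff [FiniteDimensional ℂ W] (hS : IsCRHypersurface S) :
    IsInvariantSystem (m := m) S (taylorCoeff S) where
  smooth l _ := contDiffOn_taylorCoeff hS l
  symm l l' _ h e he := taylorCoeff_perm hS h he
  order_one s e he := taylorCoeff_singleton hS s he
  order_two e he ξ hξ s := by
    have h1 := differential_taylorCoeff hS he hξ [s] (by simp)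
    obtain ⟨c, -, hc0, hcF, hcd⟩ := hξ
    have hd := hasDerivAt_comp_curve (contDiffOn_taylorCoeff hS [s]) hc0 hcF hcd
    -- Since `h_s` is identically zero on the frame bundle, its differential vanishes; the variation
    -- formula in order one then becomes the second-order relation.
    have h2 : (fun τ => taylorCoeff S [s] (c τ)) =ᶠ[𝓝 0] fun _ => 0 :=
      hcF.mono fun τ hτ => taylorCoeff_singleton hS s hτ
    have h3 := hd.unique ((hasDerivAt_const (0 : ℝ) (0 : ℝ)).congr_of_eventuallyEq h2)
    have hT : ∀ t, IsSymm fun l => taylorCoeff S (t :: l) e := fun t l l' h =>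
      taylorCoeff_perm hS (h.cons t) he
    have hH : IsSymm fun l => taylorCoeff S l e := fun l l' h => taylorCoeff_perm hS h he
    have hK : IsSymm fun l : List (Fin (2 * m)) => (1 - l.length : ℝ) * taylorCoeff S l e :=
      fun l l' h => by simp only [h.length_eq, taylorCoeff_perm hS h he]
    have hcov : ∀ a : Fin (2 * m) → ℝ, IsSymm (covector a) := by
      intro a l l' h
      rcases l with _ | ⟨s, _ | ⟨t, l⟩⟩
      · rw [h.symm.eq_nil]
      · rw [List.perm_singleton.1 h.symm]
      · rw [covector_eq_zero _ _ (by simp), covector_eq_zero _ _ (by simp [← h.length_eq])]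
    rw [h3] at h1
    simp only [leib_cons (hT _) (hcov _), leib_cons (hT _) hH, leib_cons hK (hcov _),
      leib_cons hK hH, leib_nil, covector, taylorCoeff_nil hS he, taylorCoeff_singleton hS _ he,
      List.length_cons, List.length_nil] at h1
    simp only [mul_zero, zero_mul, add_zero] at h1
    have h4 : ∀ t, taylorCoeff S [s, t] e * he.1.omega ξ (idx t) 0 =
        he.1.omega ξ (idx t) 0 * taylorCoeff S [t, s] e := fun t => by
      rw [taylorCoeff_perm hS (List.Perm.swap t s []) he, mul_comm]
    simp only [h4]
    linarith
  structure_eq l hl e he ξ hξ := by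
    have h1 := differential_taylorCoeff hS he hξ l (by rintro rfl; simp at hl)
    have hnil : taylorCoeff S [] e = 0 := taylorCoeff_nil hS he
    have hsing : ∀ s, taylorCoeff S [s] e = 0 := fun s => taylorCoeff_singleton hS s he
    simp only [structureRHS]
    -- For `p ≥ 2` the term `ω^N_s x^s` has no derivative of order `p` at `0`. What follows is
    -- matching coefficients, with `1 - (p - 1) = -(p - 2)` for the `ω^0_s` terms.
    rw [h1, covector_eq_zero _ _ (by omega),
      leib_eq_sum_Icc _ (fun k => taylorCoeff S k e) l (by simp [hnil]) hnil hsing]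
    have h0 : ∀ t, leib (fun k => taylorCoeff S (t :: k) e) (fun k => taylorCoeff S k e) l = _ :=
      fun t => leib_eq_sum_Icc (fun k => taylorCoeff S (t :: k) e) _ l (hsing t) hnil hsing
    simp only [leib_covector _ _ l hl.le, h0]
    have h2 : ∀ t, taylorCoeff S (l ++ [t]) e = taylorCoeff S (t :: l) e := fun t =>
      taylorCoeff_perm hS (List.perm_append_comm (l₁ := l) (l₂ := [t])) he
    have h3 : ∀ j ≤ l.length, ∀ U : List (Fin (2 * m)) → ℝ,
        symProd j (fun k => (1 - k.length : ℝ) * taylorCoeff S k e) U l =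
          (1 - j : ℝ) * symProd j (fun k => taylorCoeff S k e) U l := by
      intro j hj U
      rw [← symProd_const_mul]
      exact symProd_congr hj (fun k hk => by rw [hk]) fun _ _ => rfl
    have h4 : ∀ j ∈ Finset.Icc 1 (l.length - 2), (l.length.choose j : ℝ) *
        symProd j (fun k => (1 - k.length : ℝ) * taylorCoeff S k e)
          (fun k => taylorCoeff S k e) l = (l.length.choose j : ℝ) *
        ((1 - j : ℝ) * symProd j (fun k => taylorCoeff S k e)
          (fun k => taylorCoeff S k e) l) := fun j hj => by
      rw [h3 j (by have := Finset.mem_Icc.1 hj; omega)]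
    rw [Finset.sum_congr rfl h4, h3 _ (Nat.sub_le _ _), Nat.cast_sub hl.le]
    simp only [h2, mul_sub, Finset.sum_sub_distrib, Finset.sum_add_distrib, Finset.mul_sum]
    rw [Finset.sum_comm (s := Finset.Icc 1 (l.length - 2))]
    have h5 : ∀ t, ∑ j ∈ Finset.Icc 1 (l.length - 2), he.1.omega ξ (idx t) (Fin.last _) *
        ((l.length.choose j : ℝ) * symProd j (fun k => taylorCoeff S (t :: k) e)
          (fun k => taylorCoeff S k e) l) = ∑ j ∈ Finset.Icc 1 (l.length - 2),
        (l.length.choose j : ℝ) * (symProd j (fun k => taylorCoeff S (t :: k) e)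
          (fun k => taylorCoeff S k e) l * he.1.omega ξ (idx t) (Fin.last _)) := fun t =>
      Finset.sum_congr rfl fun j _ => by ring
    have h6 : ∑ j ∈ Finset.Icc 1 (l.length - 2), he.1.omega ξ 0 (Fin.last _) *
        ((l.length.choose j : ℝ) * ((1 - j : ℝ) * symProd j (fun k => taylorCoeff S k e)
          (fun k => taylorCoeff S k e) l)) = -∑ j ∈ Finset.Icc 1 (l.length - 2),
        (l.length.choose j : ℝ) * (((j : ℝ) - 1) * symProd j (fun k => taylorCoeff S k e)
          (fun k => taylorCoeff S k e) l * he.1.omega ξ 0 (Fin.last _)) := by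
      rw [← Finset.sum_neg_distrib]
      exact Finset.sum_congr rfl fun j _ => by ring
    simp only [h5, h6]
    have h7 : ∑ t, he.1.omega ξ (idx t) 0 * taylorCoeff S (t :: l) e =
        ∑ t, taylorCoeff S (t :: l) e * he.1.omega ξ (idx t) 0 :=
      Finset.sum_congr rfl fun t _ => mul_comm _ _
    rw [h7]
    push_cast
    ring

end Existence

/-! ### Moving adapted frames -/

section Frames

variable {W : Type*} [NormedAddCommGroup W] [NormedSpace ℂ W] {m : ℕ} {S : Set (ℙ ℂ W)}

theorem isFrame_of_linearIndependent (hm : Module.finrank ℂ W = m + 1)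
    {e : Fin (2 * m + 2) → W} (he : LinearIndependent ℝ e)
    (hJ : ∀ (a : ℕ) (ha : a ≤ m), Complex.I • e ⟨2 * a, by omega⟩ = e ⟨2 * a + 1, by omega⟩) :
    IsFrame m e where
  linearIndependent := he
  span_eq_top := by
    refine (he.span_eq_top_of_card_eq_finrank ?_).ge
    rw [finrank_real_of_complex, hm, Fintype.card_fin]
    ring
  J_even := hJ
  J_odd a ha := by
    rw [← hJ a ha, smul_smul, Complex.I_mul_I, neg_one_smul]

theorem IsFrame.omega_eq {e : Fin (2 * m + 2) → W} (he : IsFrame m e)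
    {ξ : Fin (2 * m + 2) → W} {k : Fin (2 * m + 2)} (c : Fin (2 * m + 2) → ℝ)
    (hc : ∑ j, c j • e j = ξ k) (j : Fin (2 * m + 2)) : he.omega ξ j k = c j := by
  have h1 : ∑ j, (he.omega ξ j k - c j) • e j = 0 := by
    simp only [sub_smul, Finset.sum_sub_distrib, hc, he.sum_omega, sub_self]
  exact sub_eq_zero.1 (Fintype.linearIndependent_iff.1 he.linearIndependent _ h1 j)

/-- Let `λ_τ` be the complex linear form with real part `dρ` at `γ(τ)`. The vectors other than `e_0,
e_1` are corrected by complex multiples of `e_{2m}` so that `λ_τ(c_k) = λ_0(e_k)`. Complex linearity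
of `λ_τ` keeps `J c_{2a} = c_{2a+1}`, and the real part keeps the values of `dρ`. -/
theorem exists_smooth_frame [FiniteDimensional ℂ W] {e : Fin (2 * m + 2) → W}
    (he : e ∈ adaptedFrames m S) {ρ : W → ℝ} {U : Set W} (h : IsLocalEquation S U ρ)
    (hU : e 0 ∈ U) (hN : fderiv ℝ ρ (e 0) (e (Fin.last _)) ≠ 0) (hm1 : 1 ≤ m) {γ : ℝ → W}
    (hγ : ContDiff ℝ ∞ γ) (hγ0 : γ 0 = e 0) :
    ∃ c : ℝ → Fin (2 * m + 2) → W, ContDiff ℝ ∞ c ∧ c 0 = e ∧ ∀ᶠ τ in 𝓝 0,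
      γ τ ∈ U ∧ c τ 0 = γ τ ∧ c τ 1 = Complex.I • γ τ ∧
      (∀ (a : ℕ) (ha : a ≤ m), Complex.I • c τ ⟨2 * a, by omega⟩ = c τ ⟨2 * a + 1, by omega⟩) ∧
      ∀ k, k ≠ 0 → k ≠ 1 → fderiv ℝ ρ (γ τ) (c τ k) = fderiv ℝ ρ (e 0) (e k) := by
  let n0 : Fin (2 * m + 2) := ⟨2 * m, by omega⟩
  have hn0 : Complex.I • e n0 = e (Fin.last _) := he.1.J_even m le_rfl
  let lam : ℝ → W → ℂ := fun τ => StrongDual.extendRCLike (𝕜 := ℂ) (fderiv ℝ ρ (γ τ))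
  have lam_add : ∀ τ u v, lam τ (u + v) = lam τ u + lam τ v := fun τ u v =>
    map_add (StrongDual.extendRCLike (𝕜 := ℂ) (fderiv ℝ ρ (γ τ))) u v
  have lam_smul : ∀ τ (c : ℂ) v, lam τ (c • v) = c * lam τ v := fun τ c v =>
    map_smul (StrongDual.extendRCLike (𝕜 := ℂ) (fderiv ℝ ρ (γ τ))) c v
  have lam_re : ∀ τ v, (lam τ v).re = fderiv ℝ ρ (γ τ) v := fun τ v =>
    StrongDual.re_extendRCLike_apply (𝕜 := ℂ) _ v
  have lam_im : ∀ τ v, (lam τ v).im = -fderiv ℝ ρ (γ τ) (Complex.I • v) := fun τ v =>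
    StrongDual.im_extendRCLike_apply (𝕜 := ℂ) _ v
  have hopen : IsOpen (γ ⁻¹' U) := h.isOpen.preimage hγ.continuous
  have hdρ : ∀ v, ContDiffOn ℝ ∞ (fun τ => fderiv ℝ ρ (γ τ) v) (γ ⁻¹' U) := fun v =>
    (contDiffOn_dirD h.isOpen h.smooth v).comp hγ.contDiffOn fun _ h => h
  have hlam : ∀ v, ContDiffOn ℝ ∞ (fun τ => lam τ v) (γ ⁻¹' U) := by
    intro v
    have h1 : (fun τ => lam τ v) = fun τ => Complex.ofRealCLM (fderiv ℝ ρ (γ τ) v)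
        - Complex.I * Complex.ofRealCLM (fderiv ℝ ρ (γ τ) (Complex.I • v)) := by
      funext τ
      apply Complex.ext
      · rw [lam_re]; simp
      · rw [lam_im]; simp
    rw [h1]
    exact (Complex.ofRealCLM.contDiff.comp_contDiffOn (hdρ v)).sub
      (contDiffOn_const.mul (Complex.ofRealCLM.contDiff.comp_contDiffOn (hdρ _)))
  let O : Set ℝ := γ ⁻¹' U ∩ (fun τ => lam τ (e n0)) ⁻¹' {0}ᶜ
  have hO : IsOpen O := (hlam _).continuousOn.isOpen_inter_preimage hopen isOpen_compl_singleton
  -- `J e_{2m} = e_{n+1}`, so the imaginary part of `λ_0(e_{2m})` is `-dρ(e_{n+1})`, although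
  -- `e_{2m}` itself is tangent.
  have hlam0 : lam 0 (e n0) ≠ 0 := by
    intro h0
    apply hN
    have := lam_im 0 (e n0)
    rw [h0, hn0, hγ0] at this
    simpa using this.symm
  have h0O : (0 : ℝ) ∈ O := ⟨by rw [Set.mem_preimage, hγ0]; exact hU, hlam0⟩
  let r : Fin (2 * m + 2) → ℝ → ℂ := fun k τ => (lam 0 (e k) - lam τ (e k)) / lam τ (e n0)
  have hr : ∀ k, ContDiffOn ℝ ∞ (r k) O := fun k => by
    have h1 : ∀ v, ContDiffOn ℝ ∞ (fun τ => lam τ v) O := fun v =>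
      (hlam v).mono Set.inter_subset_left
    simp only [r, div_eq_mul_inv]
    exact (contDiffOn_const.sub (h1 _)).mul ((h1 _).inv fun τ hτ => hτ.2)
  let c : ℝ → Fin (2 * m + 2) → W := fun τ k =>
    if k = 0 then γ τ else if k = 1 then Complex.I • γ τ else e k + r k τ • e n0
  have hc : ContDiffOn ℝ ∞ c O := by
    rw [contDiffOn_pi]
    intro k
    simp only [c]
    split_ifs
    · exact hγ.contDiffOn
    · exact (hγ.const_smul _).contDiffOn
    · exact contDiffOn_const.add ((hr k).smul contDiffOn_const)
  have h01 : (1 : Fin (2 * m + 2)) ≠ 0 := by simp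
  have hc0 : c 0 = e := by
    funext k
    simp only [c]
    split_ifs with h1 h2
    · rw [h1, hγ0]
    · rw [h2, hγ0]
      exact he.1.J_even 0 (Nat.zero_le _)
    · simp [r]
  obtain ⟨c', hc', hcc'⟩ := exists_contDiff_eventuallyEq hO h0O hc
  refine ⟨c', hc', hcc'.self_of_nhds.trans hc0, ?_⟩
  filter_upwards [hcc', hO.mem_nhds h0O] with τ h1 h2
  rw [h1]
  refine ⟨h2.1, if_pos rfl, by simp only [c, if_neg h01, if_true], fun a ha => ?_,
    fun k hk0 hk1 => ?_⟩
  · rcases Nat.eq_zero_or_pos a with rfl | hpos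
    · have : (⟨2 * 0, by omega⟩ : Fin (2 * m + 2)) = 0 := rfl
      have h3 : (⟨2 * 0 + 1, by omega⟩ : Fin (2 * m + 2)) = 1 := by ext; simp
      rw [this, h3]
      simp only [c, if_neg h01, if_true]
    · have hne : ∀ k : ℕ, 2 ≤ k → ∀ hk : k < 2 * m + 2,
          c τ ⟨k, hk⟩ = e ⟨k, hk⟩ + r ⟨k, hk⟩ τ • e n0 := by
        intro k h2 hk
        simp only [c]
        rw [if_neg, if_neg]
        · intro h
          have := congrArg Fin.val h
          simp at this
          omega
        · intro h
          have := congrArg Fin.val h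
          simp at this
          omega
      rw [hne _ (by omega), hne _ (by omega), smul_add, smul_smul, he.1.J_even a ha]
      congr 2
      simp only [r, ← he.1.J_even a ha, lam_smul]
      ring
  · have h3 : c τ k = e k + r k τ • e n0 := by simp only [c, if_neg hk0, if_neg hk1]
    have h4 : lam τ (c τ k) = lam 0 (e k) := by
      rw [h3, lam_add, lam_smul]
      simp only [r]
      rw [div_mul_cancel₀ _ h2.2]
      ring
    rw [← lam_re, h4, lam_re, hγ0]

/-- The tangent space is the kernel of `dρ`. A kernel vector expanded in the frame has no component
along the last vector, since `dρ` vanishes on all the others. -/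
theorem mem_adaptedFrames_of_fderiv {c : Fin (2 * m + 2) → W} (hc : IsFrame m c)
    (hS : c 0 ∈ cone S) {ρ : W → ℝ} {U : Set W} (h : IsLocalEquation S U ρ) (hU : c 0 ∈ U)
    (hker : ∀ j : Fin (2 * m + 1), fderiv ℝ ρ (c 0) (c j.castSucc) = 0)
    (hN : fderiv ℝ ρ (c 0) (c (Fin.last _)) ≠ 0) : c ∈ adaptedFrames m S := by
  refine ⟨hc, hS, ?_⟩
  rw [h.tangentVectors_eq hU hS fun h0 => hN (by rw [h0]; rfl)]
  refine Set.Subset.antisymm ?_ fun u hu => ?_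
  · have : Submodule.span ℝ (Set.range fun j : Fin (2 * m + 1) => c j.castSucc) ≤
        LinearMap.ker (fderiv ℝ ρ (c 0)).toLinearMap := by
      rw [Submodule.span_le]
      rintro _ ⟨j, rfl⟩
      exact hker j
    exact fun u hu => this hu
  · have h1 : ∑ j, hc.omega (fun _ => u) j 0 • c j = u := hc.sum_omega (fun _ => u) 0
    rw [Fin.sum_univ_castSucc] at h1
    have h2 : fderiv ℝ ρ (c 0) u = 0 := hu
    rw [← h1, map_add, map_sum] at h2
    simp only [map_smul, hker, smul_eq_mul, mul_zero, Finset.sum_const_zero, zero_add] at h2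
    rw [(mul_eq_zero.1 h2).resolve_right hN, zero_smul, add_zero] at h1
    rw [← h1]
    exact Submodule.sum_mem _ fun j _ => Submodule.smul_mem _ _ (Submodule.subset_span ⟨j, rfl⟩)

/-- The forms `ω^1_0, …, ω^n_0` are linearly independent on the adapted frame bundle. -/
theorem exists_tangentVector_adaptedFrames (hm : Module.finrank ℂ W = m + 1)
    (hS : IsCRHypersurface S) {e : Fin (2 * m + 2) → W} (he : e ∈ adaptedFrames m S)
    (s : Fin (2 * m)) : ∃ ξ ∈ tangentVectors (adaptedFrames m S) e,
      ∀ t, he.1.omega ξ (idx t) 0 = if t = s then 1 else 0 := by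
  have hm1 : 1 ≤ m := by have := s.2; omega
  have : FiniteDimensional ℂ W := FiniteDimensional.of_finrank_pos (by omega)
  obtain ⟨U, ρ, h, hU, hd⟩ := hS.exists_isLocalEquation he.2.1
  have hN := fderiv_last_ne_zero he h hU hd
  obtain ⟨γ, hγ, hγ0, hγS, hγd⟩ := castSucc_mem_tangentVectors he s.succ
  obtain ⟨c, hc, hc0, hev⟩ := exists_smooth_frame he h hU hN hm1 hγ hγ0
  have hcd : HasDerivAt c (deriv c 0) 0 := (hc.differentiable (by simp) 0).hasDerivAt
  have hξ0 : deriv c 0 0 = e (idx s) := by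
    have h1 := hasDerivAt_pi.1 hcd 0
    have h2 : (fun τ => c τ 0) =ᶠ[𝓝 0] γ := hev.mono fun τ hτ => hτ.2.1
    exact h1.unique (hγd.congr_of_eventuallyEq h2)
  -- Independence is an open condition, and the dimension count turns it into the basis property.
  have hLI : ∀ᶠ τ in 𝓝 (0 : ℝ), LinearIndependent ℝ (c τ) :=
    hcd.continuousAt.eventually (by rw [hc0]; exact he.1.linearIndependent.eventually)
  refine ⟨deriv c 0, ⟨c, hc, hc0, ?_, hcd⟩, fun t => ?_⟩
  · filter_upwards [hev, hLI, hγS] with τ ⟨h1, h2, h3, h4, h5⟩ h6 h7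
    have hlast0 : Fin.last (2 * m + 1) ≠ 0 := by simp
    have hlast1 : Fin.last (2 * m + 1) ≠ 1 := by
      intro h
      have := congrArg Fin.val h
      simp at this
      omega
    refine mem_adaptedFrames_of_fderiv (isFrame_of_linearIndependent hm h6 h4)
      (by rw [h2]; exact h7) h (by rw [h2]; exact h1) (fun j => ?_) ?_
    -- The vectors `γ` and `J γ` are tangent because the cone is complex-homogeneous; for the others
    -- `dρ` keeps its value from `τ = 0`, which is zero.
    · rw [h2]
      by_cases hj0 : j.castSucc = 0
      · rw [hj0, h2]
        simpa using h.fderiv_eq_zero h1 (smul_mem_tangentVectors h7 1)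
      by_cases hj1 : j.castSucc = 1
      · rw [hj1, h3]
        exact h.fderiv_eq_zero h1 (smul_mem_tangentVectors h7 Complex.I)
      · rw [h5 _ hj0 hj1]
        exact h.fderiv_eq_zero hU (castSucc_mem_tangentVectors he j)
    · rw [h2, h5 _ hlast0 hlast1]
      exact hN
  · rw [he.1.omega_eq (fun j => if j = idx s then 1 else 0) (by simp [hξ0])]
    have hinj : idx t = idx s ↔ t = s := by simp [idx]
    simp only [hinj]

end Frames

/-! ### Projective invariance -/

section Invariance

theorem map_mem_tangentVectors {E F : Type*} [NormedAddCommGroup E] [NormedSpace ℝ E]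
    [NormedAddCommGroup F] [NormedSpace ℝ F] (L : E →L[ℝ] F) {M : Set E} {M' : Set F}
    (hL : Set.MapsTo L M M') {x v : E} (hv : v ∈ tangentVectors M x) :
    L v ∈ tangentVectors M' (L x) := by
  obtain ⟨c, hc, rfl, hM, hd⟩ := hv
  exact ⟨fun τ => L (c τ), L.contDiff.comp hc, rfl, hM.mono fun τ hτ => hL hτ,
    L.hasFDerivAt.comp_hasDerivAt 0 hd⟩

variable {W : Type*} [NormedAddCommGroup W] [NormedSpace ℂ W] {m : ℕ} {S : Set (ℙ ℂ W)}

theorem apply_mem_cone_image (A : W ≃ₗ[ℂ] W) {v : W} :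
    A v ∈ cone (Projectivization.map (A : W →ₗ[ℂ] W) A.injective '' S) ↔ v ∈ cone S := by
  constructor
  · rintro ⟨hv, p, hp, hpv⟩
    have hv0 : v ≠ 0 := fun h => hv (by rw [h, map_zero])
    refine ⟨hv0, ?_⟩
    have h1 : Projectivization.mk ℂ (A v) hv =
        Projectivization.map (A : W →ₗ[ℂ] W) A.injective (Projectivization.mk ℂ v hv0) := rfl
    rw [h1] at hpv
    rwa [← Projectivization.map_injective _ A.injective hpv]
  · rintro ⟨hv, hS⟩
    exact ⟨A.map_ne_zero_iff.2 hv, _, hS, rfl⟩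

/-- A complex linear automorphism, as a real continuous linear equivalence. -/
def realEquiv [FiniteDimensional ℂ W] (A : W ≃ₗ[ℂ] W) : W ≃L[ℝ] W :=
  A.toContinuousLinearEquiv.restrictScalars ℝ

@[simp] theorem realEquiv_apply [FiniteDimensional ℂ W] (A : W ≃ₗ[ℂ] W) (v : W) :
    realEquiv A v = A v := rfl

theorem tangentVectors_cone_image [FiniteDimensional ℂ W] (A : W ≃ₗ[ℂ] W) (v : W) :
    tangentVectors (cone (Projectivization.map (A : W →ₗ[ℂ] W) A.injective '' S)) (A v) =
      A '' tangentVectors (cone S) v := by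
  apply Set.Subset.antisymm
  · intro u hu
    refine ⟨A.symm u, ?_, by simp⟩
    have h1 := map_mem_tangentVectors (realEquiv A).symm.toContinuousLinearMap
      (M' := cone S) (fun w hw => ?_) hu
    · have h2 : (realEquiv A).symm (A v) = v := (realEquiv A).symm_apply_apply v
      have h3 : (realEquiv A).symm u = A.symm u :=
        (realEquiv A).injective (by simp)
      simpa [h2, h3] using h1
    · rw [← apply_mem_cone_image A]
      have : A ((realEquiv A).symm w) = w := (realEquiv A).apply_symm_apply w
      simpa [this] using hw
  · rintro _ ⟨u, hu, rfl⟩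
    exact map_mem_tangentVectors (realEquiv A).toContinuousLinearMap
      (fun w hw => (apply_mem_cone_image A).2 hw) hu

theorem IsFrame.map {e : Fin (2 * m + 2) → W} (he : IsFrame m e) (A : W ≃ₗ[ℂ] W) :
    IsFrame m fun j => A (e j) where
  linearIndependent := he.linearIndependent.map' ((A.restrictScalars ℝ : W ≃ₗ[ℝ] W) : W →ₗ[ℝ] W)
    (A.restrictScalars ℝ).ker
  span_eq_top := by
    intro w _
    have h1 := he.sum_omega (fun _ => A.symm w) 0
    have h2 := congrArg (A.restrictScalars ℝ) h1
    rw [map_sum] at h2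
    have h3 : (A.restrictScalars ℝ) (A.symm w) = w := A.apply_symm_apply w
    rw [h3] at h2
    rw [← h2]
    refine Submodule.sum_mem _ fun j _ => ?_
    rw [map_smul]
    exact Submodule.smul_mem _ _ (Submodule.subset_span ⟨j, rfl⟩)
  J_even a ha := by rw [← map_smul, he.J_even a ha]
  J_odd a ha := by rw [← map_smul, he.J_odd a ha, map_neg]

theorem IsFrame.omega_map {e : Fin (2 * m + 2) → W} (he : IsFrame m e) (A : W ≃ₗ[ℂ] W)
    (ξ : Fin (2 * m + 2) → W) (he' : IsFrame m fun j => A (e j)) :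
    he'.omega (fun j => A (ξ j)) = he.omega ξ := by
  funext j k
  refine he'.omega_eq (fun j => he.omega ξ j k) ?_ j
  have h1 := congrArg (A.restrictScalars ℝ) (he.sum_omega ξ k)
  rw [map_sum] at h1
  simp only [map_smul] at h1
  exact h1

theorem map_mem_adaptedFrames [FiniteDimensional ℂ W] (A : W ≃ₗ[ℂ] W)
    {e : Fin (2 * m + 2) → W} (he : e ∈ adaptedFrames m S) :
    (fun j => A (e j)) ∈ adaptedFrames m
      (Projectivization.map (A : W →ₗ[ℂ] W) A.injective '' S) := by
  refine ⟨he.1.map A, (apply_mem_cone_image A).2 he.2.1, ?_⟩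
  rw [tangentVectors_cone_image, ← he.2.2]
  have h1 := Submodule.map_span ((A.restrictScalars ℝ : W ≃ₗ[ℝ] W) : W →ₗ[ℝ] W)
    (Set.range fun j : Fin (2 * m + 1) => e j.castSucc)
  rw [← Set.range_comp] at h1
  exact (congrArg (fun P : Submodule ℝ W => (P : Set W)) h1).symm

theorem map_mem_tangentVectors_adaptedFrames [FiniteDimensional ℂ W] (A : W ≃ₗ[ℂ] W)
    {e ξ : Fin (2 * m + 2) → W} (hξ : ξ ∈ tangentVectors (adaptedFrames m S) e) :
    (fun j => A (ξ j)) ∈ tangentVectors (adaptedFrames m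
      (Projectivization.map (A : W →ₗ[ℂ] W) A.injective '' S)) fun j => A (e j) :=
  map_mem_tangentVectors (ContinuousLinearMap.pi fun j =>
    (realEquiv A).toContinuousLinearMap.comp (ContinuousLinearMap.proj j))
    (fun _ he => map_mem_adaptedFrames A he) hξ

/-- Only functions of order at most `p` occur on the right: in `h_{t s_1 … s_j}` one has `j + 1 ≤
p`. Agreement is assumed on the whole frame bundle, not just at `e`, because `h_{s_1 … s_p}` is also
differentiated. -/
theorem structureRHS_map [FiniteDimensional ℂ W] (A : W ≃ₗ[ℂ] W)
    {h h' : List (Fin (2 * m)) → (Fin (2 * m + 2) → W) → ℝ} (hh : IsInvariantSystem S h)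
    (hh' : IsInvariantSystem (Projectivization.map (A : W →ₗ[ℂ] W) A.injective '' S) h')
    {l : List (Fin (2 * m))} (hl : 1 < l.length)
    (heq : ∀ k : List (Fin (2 * m)), 2 ≤ k.length → k.length ≤ l.length →
      ∀ e ∈ adaptedFrames m S, h' k (fun j => A (e j)) = h k e)
    {e ξ : Fin (2 * m + 2) → W} (he : e ∈ adaptedFrames m S)
    (hξ : ξ ∈ tangentVectors (adaptedFrames m S) e) (he' : IsFrame m fun j => A (e j)) :
    structureRHS (Projectivization.map (A : W →ₗ[ℂ] W) A.injective '' S) h' he'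
      (fun j => A (ξ j)) l = structureRHS S h he.1 ξ l := by
  have hd : differential (adaptedFrames m (Projectivization.map (A : W →ₗ[ℂ] W) A.injective '' S))
      (h' l) (fun j => A (e j)) (fun j => A (ξ j)) =
      differential (adaptedFrames m S) (h l) e ξ := by
    obtain ⟨c, -, hc0, hcF, hcd⟩ := hξ
    have h1 := hasDerivAt_comp_curve (hh.smooth l hl) hc0 hcF hcd
    have hcd' : HasDerivAt (fun τ j => A (c τ j)) (fun j => A (ξ j)) 0 := by
      rw [hasDerivAt_pi] at hcd ⊢
      exact fun j => (realEquiv A).toContinuousLinearMap.hasFDerivAt.comp_hasDerivAt 0 (hcd j)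
    have h2 := hasDerivAt_comp_curve (x := fun j => A (e j)) (hh'.smooth l hl) (by rw [hc0])
      (hcF.mono fun τ hτ => map_mem_adaptedFrames A hτ) hcd'
    exact h2.unique (h1.congr_of_eventuallyEq (hcF.mono fun τ hτ => heq l hl le_rfl _ hτ))
  have hH : ∀ k : List (Fin (2 * m)), 1 ≤ k.length → k.length ≤ l.length →
      h' k (fun j => A (e j)) = h k e := by
    intro k h1 h2
    rcases Nat.eq_or_lt_of_le h1 with h3 | h3
    · obtain ⟨s, rfl⟩ := List.length_eq_one_iff.1 h3.symm
      rw [hh.order_one s e he, hh'.order_one s _ (map_mem_adaptedFrames A he)]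
    · exact heq k h3 h2 e he
  simp only [structureRHS]
  rw [hd, IsFrame.omega_map he.1 A ξ he', hH l (by omega) le_rfl]
  have h1 : ∀ U, symProd (l.length - 1) (fun k => h' k fun j => A (e j)) U l =
      symProd (l.length - 1) (fun k => h k e) U l := fun U =>
    symProd_congr (Nat.sub_le _ _) (fun k hk => hH k (by omega) (by omega)) fun _ _ => rfl
  have h2 : ∀ t U, symProd (l.length - 1) (fun k => h' (t :: k) fun j => A (e j)) U l =
      symProd (l.length - 1) (fun k => h (t :: k) e) U l := fun t U =>
    symProd_congr (Nat.sub_le _ _) (fun k hk => hH _ (by simp)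
      (by rw [List.length_cons]; omega)) fun _ _ => rfl
  simp only [h1, h2]
  congr 1
  refine Finset.sum_congr rfl fun j hj => ?_
  obtain ⟨hj1, hj2⟩ := Finset.mem_Icc.1 hj
  have h3 : symProd j (fun k => h' k fun j => A (e j)) (fun k => h' k fun j => A (e j)) l =
      symProd j (fun k => h k e) (fun k => h k e) l :=
    symProd_congr (by omega) (fun k hk => hH k (by omega) (by omega))
      fun k hk => hH k (by omega) (by omega)
  have h4 : ∀ t, symProd j (fun k => h' (t :: k) fun j => A (e j))
      (fun k => h' k fun j => A (e j)) l =
      symProd j (fun k => h (t :: k) e) (fun k => h k e) l := fun t =>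
    symProd_congr (by omega) (fun k hk => hH _ (by simp)
      (by rw [List.length_cons]; omega)) fun k hk => hH k (by omega) (by omega)
  simp only [h3, h4]

/-- Strong induction on the order: peel off the last index `s` and evaluate both equations on a
tangent vector with `ω^t_0 = δ^t_s`, which isolates the coefficient to be compared. -/
theorem IsInvariantSystem.map_eq (hm : Module.finrank ℂ W = m + 1) (hS : IsCRHypersurface S)
    (A : W ≃ₗ[ℂ] W) {h h' : List (Fin (2 * m)) → (Fin (2 * m + 2) → W) → ℝ}
    (hh : IsInvariantSystem S h)
    (hh' : IsInvariantSystem (Projectivization.map (A : W →ₗ[ℂ] W) A.injective '' S) h')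
    (l : List (Fin (2 * m))) (hl : 2 ≤ l.length) :
    ∀ e ∈ adaptedFrames m S, h' l (fun j => A (e j)) = h l e := by
  have : FiniteDimensional ℂ W := FiniteDimensional.of_finrank_pos (by omega)
  induction hn : l.length using Nat.strong_induction_on generalizing l with
  | _ n ih =>
    subst hn
    intro e he
    obtain ⟨l, s, rfl⟩ := (List.eq_nil_or_concat l).resolve_left (by rintro rfl; simp at hl)
    rw [List.concat_eq_append] at *
    have he' := map_mem_adaptedFrames A he
    obtain ⟨ξ, hξ, hω⟩ := exists_tangentVector_adaptedFrames hm hS he s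
    have hξ' := map_mem_tangentVectors_adaptedFrames A hξ
    have hsum : ∀ f : Fin (2 * m) → ℝ, ∑ t, f t * he.1.omega ξ (idx t) 0 = f s := by
      intro f
      simp [hω]
    rw [← hsum fun t => h' (l ++ [t]) fun j => A (e j), ← hsum fun t => h (l ++ [t]) e]
    have hom := IsFrame.omega_map he.1 A ξ he'.1
    simp only [List.length_append, List.length_singleton] at hl ih
    -- Order two comes from the relation for `ω^{n+1}_s`, where both sides are read off from the
    -- frame; higher orders come from the structure equation.
    rcases Nat.eq_or_lt_of_le (show 1 ≤ l.length by omega) with h1 | h1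
    · obtain ⟨r, rfl⟩ := List.length_eq_one_iff.1 h1.symm
      have h2 := hh.order_two e he ξ hξ r
      have h3 := hh'.order_two _ he' _ hξ' r
      rw [hom, h2] at h3
      exact h3.symm
    · have h2 := hh.structure_eq l h1 e he ξ hξ
      have h3 := hh'.structure_eq l h1 _ he' _ hξ'
      rw [hom, structureRHS_map A hh hh' h1
        (fun k hk hkl => ih k.length (by omega) k hk rfl) he hξ, ← h2] at h3
      exact h3

end Invariance

end

end CRProj

theorem propositionP {W : Type*} [NormedAddCommGroup W] [NormedSpace ℂ W] (m : ℕ)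
    (hm : Module.finrank ℂ W = m + 1) (S : Set (Projectivization ℂ W))
    (hS : CRProj.IsCRHypersurface S) :
    (∃ h : List (Fin (2 * m)) → (Fin (2 * m + 2) → W) → ℝ, CRProj.IsInvariantSystem S h) ∧
    (∀ (A : W ≃ₗ[ℂ] W) (h h' : List (Fin (2 * m)) → (Fin (2 * m + 2) → W) → ℝ),
      CRProj.IsInvariantSystem S h →
      CRProj.IsInvariantSystem
        (Projectivization.map (A : W →ₗ[ℂ] W) A.injective '' S) h' →
      ∀ e ∈ CRProj.adaptedFrames m S,
        (fun j => A (e j)) ∈ CRProj.adaptedFrames m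
          (Projectivization.map (A : W →ₗ[ℂ] W) A.injective '' S) ∧
        ∀ l : List (Fin (2 * m)), 2 ≤ l.length → h' l (fun j => A (e j)) = h l e) := by
  have : FiniteDimensional ℂ W := FiniteDimensional.of_finrank_pos (by omega)
  exact ⟨⟨_, CRProj.isInvariantSystem_taylorCoeff hS⟩, fun A h h' hh hh' e he =>
    ⟨CRProj.map_mem_adaptedFrames A he, fun l hl => hh.map_eq hm hS A hh' l hl e he⟩⟩
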